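/- Graphs are simple and undirected (possibly infinite); a graph map is a map of vertex sets that sends each edge to an edge or to a vertex; its image is the subgraph formed by the images of the vertices and those edges that are images of edges. Let $I^n$ be the discrete $n$-cube graph on $\{0,1\}^n$ (adjacent = differing in exactly one coordinate). A singular $n$-cube in a graph $G$ is a graph map $\sigma\colon I^n\to G$, with front and back faces $f_i^{-}\sigma, f_i^{+}\sigma$ obtained by fixing the $i$-th coordinate to $0$, respectively $1$, and boundary $\partial\sigma=\sum_{i=1}^n(-1)^i(f_i^-\sigma-f_i^+\sigma)$; it is degenerate if $f_i^-\sigma=f_i^+\sigma$ for some $i$. The discrete cubical homology $H_n(G)$ is the homology of $C_*(G)=Q_*(G)/D_*(G)$, where $Q_n(G)$ is the free abelian group on the singular $n$-cubes and $D_n(G)$ is the subgroup generated by the degenerate ones. Let $CW^\Box(G)$ be the CW complex with one $n$-cell for each subgraph of $G$ isomorphic to $I^n$, glued along faces. Its cellular chain group in degree $n$ is the free abelian group on the injective singular $n$-cubes modulo $\sigma\circ T_i=-\sigma$ and $\sigma\circ T_{i,j}=-\sigma$ ($i\ne j$), where $T_i$ reflects the $i$-th coordinate and $T_{i,j}$ swaps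 the $i$-th and $j$-th coordinates, with the boundary given by the formula above; $H_n(CW^\Box(G))$ is the homology of this complex. A graph $G$ is $n$-quasimonophobic if every subgraph $Q\subseteq G$ isomorphic to $I^n$ is an induced subgraph, and whenever a non-injective singular $(n+1)$-cube in $G$ has a face with image $Q$, it has at least one further face (as an indexed face $f_j^{\pm}$) with image $Q$. Let $X$ be a semi-cubical set that is regular: every characteristic map $[0,1]^n\to|X|$ into its geometric realization is injective. Let $G(X)$ be the simple graph given by its $1$-skeleton (vertices: the $0$-cells; two distinct vertices are adjacent if some $1$-cell joins them). Each $n$-cell of $X$ determines, through its corners, an injective singular $n$-cube $I^n\to G(X)$. Let $x=\sum_i a_i\sigma_i$ be a cycle in the cubical chains $\mathbb{Z}X_n$. Regarding the cells $\sigma_i$ as singular cubes gives a class $[x]_{\mathrm{graph}}\in H_n(G(X))$; regarding them as cells of $CW^\Box(G(X))$ gives a class $[x]_{CW}\in H_n(CW^\Box(G(X)))$, the image of $[x]\in H_n(|X|)$ under the cellular map $|X|\to CW^\Box(G(X))$. **Theorem.** Let $n\ge 0$, let $X$ be a regular semi-cubical set, let $x\in\mathbb{Z}X_n$ be an $n$-cycle,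 let $G$ be an $n$-quasimonophobic graph, and let $\alpha\colon G(X)\hookrightarrow G$ be an injective graph map. If the homology class $\alpha_*[x]_{CW}\in H_n(CW^\Box(G))$ is non-zero, then the homology class $\alpha_*[x]_{\mathrm{graph}}\in H_n(G)$ is non-zero. -/

import Mathlib

open CategoryTheory

universe u

namespace DiscreteCubical

/-! ## Semi-cubical sets and their chains -/

/-- A semi-cubical set (a presheaf on the category of cubes and injective face inclusions),
given by its cells and its face maps; `face false i` and `face true i` are the front face
`f_i^-` and the back face `f_i^+` in the direction `i` (directions are numbered from `0`). -/
structure SemiCubicalSet where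
  cells : ℕ → Type u
  face : {n : ℕ} → Bool → Fin (n + 1) → cells (n + 1) → cells n
  face_face : ∀ {n : ℕ} (a b : Bool) (i j : Fin (n + 1)), i ≤ j → ∀ c : cells (n + 2),
    face a i (face b j.succ c) = face b j (face a i.castSucc c)

namespace SemiCubicalSet

/-- A map of semi-cubical sets. -/
structure Hom (X Y : SemiCubicalSet.{u}) where
  app : (n : ℕ) → X.cells n → Y.cells n
  app_face : ∀ {n : ℕ} (b : Bool) (i : Fin (n + 1)) (c : X.cells (n + 1)),
    app n (X.face b i c) = Y.face b i (app (n + 1) c)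

theorem face_face' (X : SemiCubicalSet.{u}) {n : ℕ} (a b : Bool) (j : Fin (n + 2))
    (i : Fin (n + 1)) (c : X.cells (n + 2)) :
    X.face a i (X.face b j c) = X.face b (i.predAbove j) (X.face a (j.succAbove i) c) := by
  rcases lt_or_ge i.castSucc j with h | h
  · obtain ⟨k, rfl⟩ := Fin.exists_succ_eq.mpr (Fin.ne_zero_of_lt h)
    rw [Fin.succAbove_of_castSucc_lt _ _ h, Fin.predAbove_of_castSucc_lt _ _ h, Fin.pred_succ]
    exact X.face_face a b i k (Fin.castSucc_lt_succ_iff.mp h) c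
  · obtain ⟨k, rfl⟩ : ∃ k : Fin (n + 1), j = k.castSucc :=
      ⟨j.castPred (Fin.ne_last_of_lt (lt_of_le_of_lt h (Fin.castSucc_lt_last i))), by simp⟩
    rw [Fin.succAbove_of_le_castSucc _ _ h, Fin.predAbove_of_le_castSucc _ _ h,
      Fin.castPred_castSucc]
    exact (X.face_face b a k i (Fin.castSucc_le_castSucc_iff.mp h) c).symm

/-- The cubical boundary `∂ c = ∑_{i = 1}^{n} (-1)^i (f_i^- c - f_i^+ c)` on free chains. -/
noncomputable def boundary (X : SemiCubicalSet.{u}) (n : ℕ) :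
    (X.cells (n + 1) →₀ ℤ) →ₗ[ℤ] (X.cells n →₀ ℤ) :=
  Finsupp.linearCombination ℤ fun c => ∑ i : Fin (n + 1), (-1 : ℤ) ^ ((i : ℕ) + 1) •
    (Finsupp.single (X.face false i c) (1 : ℤ) - Finsupp.single (X.face true i c) (1 : ℤ))

theorem boundary_single (X : SemiCubicalSet.{u}) {n : ℕ} (c : X.cells (n + 1)) :
    X.boundary n (Finsupp.single c 1) = ∑ i : Fin (n + 1), (-1 : ℤ) ^ ((i : ℕ) + 1) •
      (Finsupp.single (X.face false i c) (1 : ℤ) - Finsupp.single (X.face true i c) (1 : ℤ)) := by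
  simp [boundary]

theorem boundary_boundary (X : SemiCubicalSet.{u}) (n : ℕ) :
    X.boundary n ∘ₗ X.boundary (n + 1) = 0 := by
  apply Finsupp.lhom_ext'
  intro c
  apply LinearMap.ext_ring
  simp only [LinearMap.comp_apply, Finsupp.lsingle_apply, LinearMap.zero_apply]
  rw [boundary_single]
  simp only [map_sum, map_smul, map_sub, boundary_single, Finset.smul_sum,
    ← Finset.sum_sub_distrib]
  rw [← Finset.sum_product', Finset.univ_product_univ]
  refine Finset.sum_involution (fun p _ => (p.1.succAbove p.2, p.2.predAbove p.1)) ?_ ?_ ?_ ?_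
  · rintro ⟨j, i⟩ -
    have hs := Fin.neg_one_pow_succAbove_add_predAbove (R := ℤ) j i
    simp only [X.face_face' _ _ j i]
    have e1 : ((-1 : ℤ) ^ (((j.succAbove i : Fin (n + 2)) : ℕ) + 1)
        * (-1) ^ (((i.predAbove j : Fin (n + 1)) : ℕ) + 1))
        = -((-1 : ℤ) ^ ((j : ℕ) + 1) * (-1) ^ ((i : ℕ) + 1)) := by
      rw [← pow_add, ← pow_add]
      have : ∀ a b : ℕ, (-1 : ℤ) ^ (a + 1 + (b + 1)) = (-1) ^ (a + b) := by
        intro a b; ring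
      rw [this, this, hs]
    simp only [← smul_sub, smul_smul, e1]
    rw [neg_smul, ← sub_eq_add_neg, ← smul_sub]
    convert smul_zero _ using 2
    abel
  · rintro ⟨j, i⟩ - - h
    simp only [Prod.mk.injEq] at h
    exact Fin.succAbove_ne j i h.1
  · simp
  · rintro ⟨j, i⟩ -
    simp [Fin.succAbove_succAbove_predAbove, Fin.predAbove_predAbove_succAbove]

/-- The quotient of the cubical chain complex of `X` by subgroups `D n` of the chain groups
that are preserved by the boundary. -/
noncomputable abbrev quotientChains (X : SemiCubicalSet.{u})
    (D : (n : ℕ) → Submodule ℤ (X.cells n →₀ ℤ))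
    (hD : ∀ n, D (n + 1) ≤ (D n).comap (X.boundary n)) : ChainComplex (ModuleCat.{u} ℤ) ℕ :=
  ChainComplex.of (fun n => ModuleCat.of ℤ ((X.cells n →₀ ℤ) ⧸ D n))
    (fun n => ModuleCat.ofHom ((D (n + 1)).mapQ (D n) (X.boundary n) (hD n)))
    (fun n => by
      rw [← ModuleCat.ofHom_comp, ← Submodule.mapQ_comp]
      ext x
      have := LinearMap.congr_fun (X.boundary_boundary n) (Finsupp.single x 1)
      simp only [LinearMap.comp_apply, LinearMap.zero_apply] at this
      simp [this])

/-- The cubical chain complex `C_*(X)` with `C_n(X) = ℤ X_n`. -/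
noncomputable abbrev chains (X : SemiCubicalSet.{u}) : ChainComplex (ModuleCat.{u} ℤ) ℕ :=
  ChainComplex.of (fun n => ModuleCat.of ℤ (X.cells n →₀ ℤ))
    (fun n => ModuleCat.ofHom (X.boundary n))
    (fun n => by rw [← ModuleCat.ofHom_comp, X.boundary_boundary, ModuleCat.ofHom_zero])

theorem quotientChains_d (X : SemiCubicalSet.{u})
    (D : (n : ℕ) → Submodule ℤ (X.cells n →₀ ℤ))
    (hD : ∀ n, D (n + 1) ≤ (D n).comap (X.boundary n)) (n : ℕ) :
    (X.quotientChains D hD).d (n + 1) n =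
      ModuleCat.ofHom ((D (n + 1)).mapQ (D n) (X.boundary n) (hD n)) :=
  ChainComplex.of_d (V := ModuleCat.{u} ℤ)
    (fun n => ModuleCat.of ℤ ((X.cells n →₀ ℤ) ⧸ D n))
    (fun n => ModuleCat.ofHom ((D (n + 1)).mapQ (D n) (X.boundary n) (hD n))) n

theorem chains_d (X : SemiCubicalSet.{u}) (n : ℕ) :
    X.chains.d (n + 1) n = ModuleCat.ofHom (X.boundary n) :=
  ChainComplex.of_d (V := ModuleCat.{u} ℤ) (fun n => ModuleCat.of ℤ (X.cells n →₀ ℤ))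
    (fun n => ModuleCat.ofHom (X.boundary n)) n

theorem Hom.mapDomain_boundary {X Y : SemiCubicalSet.{u}} (f : X.Hom Y) (n : ℕ) :
    Finsupp.lmapDomain ℤ ℤ (f.app n) ∘ₗ X.boundary n =
      Y.boundary n ∘ₗ Finsupp.lmapDomain ℤ ℤ (f.app (n + 1)) := by
  apply Finsupp.lhom_ext'
  intro c
  apply LinearMap.ext_ring
  simp only [LinearMap.comp_apply, Finsupp.lsingle_apply, boundary_single,
    Finsupp.lmapDomain_apply, Finsupp.mapDomain_single, map_sum, map_smul, map_sub,
    ← f.app_face]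

/-- The chain map `C_*(X) → C_*(Y) / D` induced by a map `X → Y` of semi-cubical sets. -/
noncomputable def Hom.toQuotientChains {X Y : SemiCubicalSet.{u}} (f : X.Hom Y)
    (D : (n : ℕ) → Submodule ℤ (Y.cells n →₀ ℤ))
    (hD : ∀ n, D (n + 1) ≤ (D n).comap (Y.boundary n)) : X.chains ⟶ Y.quotientChains D hD :=
  ChainComplex.ofHom
    (fun n => ModuleCat.ofHom ((D n).mkQ ∘ₗ Finsupp.lmapDomain ℤ ℤ (f.app n)))
    (fun n => by
      rw [chains_d, quotientChains_d, ← ModuleCat.ofHom_comp, ← ModuleCat.ofHom_comp,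
        LinearMap.comp_assoc, f.mapDomain_boundary, ← LinearMap.comp_assoc, Submodule.mapQ_mkQ,
        LinearMap.comp_assoc])

/-- The chain map `C_*(X) / D → C_*(Y) / E` induced by a map `X → Y` of semi-cubical sets
that carries `D` into `E`. -/
noncomputable def Hom.quotientMap {X Y : SemiCubicalSet.{u}} (f : X.Hom Y)
    (D : (n : ℕ) → Submodule ℤ (X.cells n →₀ ℤ))
    (hD : ∀ n, D (n + 1) ≤ (D n).comap (X.boundary n))
    (E : (n : ℕ) → Submodule ℤ (Y.cells n →₀ ℤ))
    (hE : ∀ n, E (n + 1) ≤ (E n).comap (Y.boundary n))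
    (hf : ∀ n, D n ≤ (E n).comap (Finsupp.lmapDomain ℤ ℤ (f.app n))) :
    X.quotientChains D hD ⟶ Y.quotientChains E hE :=
  ChainComplex.ofHom
    (fun n => ModuleCat.ofHom ((D n).mapQ (E n) (Finsupp.lmapDomain ℤ ℤ (f.app n)) (hf n)))
    (fun n => by
      rw [quotientChains_d, quotientChains_d, ← ModuleCat.ofHom_comp, ← ModuleCat.ofHom_comp,
        ← Submodule.mapQ_comp,
        ← Submodule.mapQ_comp]
      congr 2
      exact (f.mapDomain_boundary n).symm)

end SemiCubicalSet

/-- A chain of a complex of abelian groups in degree `n` is a cycle if its boundary vanishes. -/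
def IsCycle (K : ChainComplex (ModuleCat.{u} ℤ) ℕ) {n : ℕ} (x : K.X n) : Prop :=
  ∀ m, K.d n m x = 0

/-- The homology class of a cycle. -/
noncomputable def cycleClass (K : ChainComplex (ModuleCat.{u} ℤ) ℕ) {n : ℕ} (x : K.X n)
    (hx : IsCycle K x) : K.homology n :=
  K.homologyπ n (K.cyclesMk x _ rfl (hx _))

/-! ## Graphs, graph maps and singular cubes -/

/-- A graph map sends every edge to an edge or to a vertex. -/
@[ext] structure GraphMap {V W : Type*} (G : SimpleGraph V) (H : SimpleGraph W) where
  toFun : V → W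
  map_adj : ∀ v w, G.Adj v w → H.Adj (toFun v) (toFun w) ∨ toFun v = toFun w

namespace GraphMap

variable {U V W : Type*} {F : SimpleGraph U} {G : SimpleGraph V} {H : SimpleGraph W}

/-- Composition of graph maps. -/
def comp (g : GraphMap G H) (f : GraphMap F G) : GraphMap F H where
  toFun := g.toFun ∘ f.toFun
  map_adj v w h := by
    rcases f.map_adj v w h with h | h
    · exact g.map_adj _ _ h
    · exact Or.inr (congrArg g.toFun h)

/-- The image of a graph map: its edges are the images of the edges of the source. -/
def image (f : GraphMap G H) : H.Subgraph where
  verts := Set.range f.toFun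
  Adj a b := H.Adj a b ∧ ∃ v w, G.Adj v w ∧ f.toFun v = a ∧ f.toFun w = b
  adj_sub h := h.1
  edge_vert := by
    rintro a b ⟨-, v, w, -, rfl, -⟩
    exact ⟨v, rfl⟩
  symm := ⟨by
    rintro a b ⟨h, v, w, hvw, hv, hw⟩
    exact ⟨h.symm, w, v, hvw.symm, hw, hv⟩⟩

end GraphMap

/-- The discrete `n`-cube `I^n`: two vertices are adjacent if they differ in exactly one
coordinate. -/
def cubeGraph (n : ℕ) : SimpleGraph (Fin n → Bool) where
  Adj s t := ∃! i, s i ≠ t i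
  symm := ⟨fun s t h => by simpa only [ne_comm] using h⟩
  loopless := ⟨fun s ⟨i, hi, _⟩ => hi rfl⟩

/-- A singular `n`-cube in a graph. -/
abbrev SingCube {V : Type u} (G : SimpleGraph V) (n : ℕ) : Type u :=
  GraphMap (cubeGraph n) G

theorem cubeGraph_adj_insertNth {n : ℕ} (i : Fin (n + 1)) (b : Bool) {s t : Fin n → Bool}
    (h : (cubeGraph n).Adj s t) :
    (cubeGraph (n + 1)).Adj (i.insertNth b s) (i.insertNth b t) := by
  obtain ⟨k, hk, hu⟩ := h
  refine ⟨i.succAbove k, by simpa using hk, fun m hm => ?_⟩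
  rcases Fin.eq_self_or_eq_succAbove i m with rfl | ⟨m, rfl⟩
  · simp at hm
  · rw [hu m (by simpa using hm)]

namespace SingCube

variable {V : Type u} {G : SimpleGraph V}

/-- The `i`-th front (`b = false`) or back (`b = true`) face of a singular cube: fix the `i`-th
coordinate equal to `0` or to `1`. -/
def face {n : ℕ} (b : Bool) (i : Fin (n + 1)) (σ : SingCube G (n + 1)) : SingCube G n where
  toFun t := σ.toFun (i.insertNth b t)
  map_adj _ _ h := σ.map_adj _ _ (cubeGraph_adj_insertNth i b h)

/-- A singular cube is degenerate if a front face equals the opposite back face. -/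
def IsDegenerate : {n : ℕ} → SingCube G n → Prop
  | 0, _ => False
  | _ + 1, σ => ∃ i, face false i σ = face true i σ

/-- The singular cube `σ ∘ T_i`, where `T_i` reflects the `i`-th coordinate of the cube. -/
def flip {n : ℕ} (i : Fin n) (σ : SingCube G n) : SingCube G n where
  toFun t := σ.toFun (Function.update t i (!(t i)))
  map_adj s t h := σ.map_adj _ _ (by
    obtain ⟨k, hk, hu⟩ := h
    have key : ∀ m, (Function.update s i (!(s i)) m ≠ Function.update t i (!(t i)) m) ↔
        s m ≠ t m := by
      intro m
      by_cases hm : m = i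
      · subst hm; simp
      · simp [hm]
    exact ⟨k, (key k).mpr hk, fun m hm => hu m ((key m).mp hm)⟩)

/-- The singular cube `σ ∘ T_π`, where `T_π` permutes the coordinates of the cube by `π`.
For the transposition `π = swap i j` this is `σ ∘ T_{i,j}`. -/
def permute {n : ℕ} (π : Equiv.Perm (Fin n)) (σ : SingCube G n) : SingCube G n where
  toFun t := σ.toFun (t ∘ π)
  map_adj s t h := σ.map_adj _ _ (by
    obtain ⟨k, hk, hu⟩ := h
    refine ⟨π.symm k, by simpa using hk, fun m hm => ?_⟩
    rw [← hu (π m) hm, Equiv.symm_apply_apply])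

end SingCube

theorem insertNth_insertNth {n : ℕ} (a b : Bool) (i j : Fin (n + 1)) (hij : i ≤ j)
    (t : Fin n → Bool) :
    (j.succ.insertNth b (i.insertNth a t) : Fin (n + 2) → Bool) =
      i.castSucc.insertNth a (j.insertNth b t) := by
  have h1 : j.succ.succAbove i = i.castSucc :=
    Fin.succAbove_of_castSucc_lt _ _ (Fin.castSucc_lt_succ_iff.mpr hij)
  have h2 : i.predAbove j.succ = j := by
    rw [Fin.predAbove_of_castSucc_lt _ _ (Fin.castSucc_lt_succ_iff.mpr hij), Fin.pred_succ]
  rw [Fin.insertNth_eq_iff]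
  constructor
  · have h3 : i.castSucc.succAbove j = j.succ :=
      Fin.succAbove_of_le_castSucc _ _ (Fin.castSucc_le_castSucc_iff.mpr hij)
    rw [← h3]; simp
  · rw [Fin.insertNth_eq_iff]
    constructor
    · simp [Fin.removeNth, h1]
    · rw [Fin.removeNth_removeNth_eq_swap, h1, h2]; simp

variable {V W : Type u}

/-- The semi-cubical set of singular cubes of a graph. -/
def sing (G : SimpleGraph V) : SemiCubicalSet.{u} where
  cells n := SingCube G n
  face b i σ := SingCube.face b i σ
  face_face a b i j hij σ := by
    ext t
    exact congrArg σ.toFun (insertNth_insertNth a b i j hij t)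

/-! ## Discrete cubical homology of a graph -/

/-- The subgroup `D_n(G)` spanned by the degenerate singular cubes. -/
noncomputable def degenerateChains (G : SimpleGraph V) (n : ℕ) : Submodule ℤ ((sing G).cells n →₀ ℤ) :=
  Submodule.span ℤ {x | ∃ σ : (sing G).cells n, SingCube.IsDegenerate σ ∧ x = Finsupp.single σ 1}

theorem degenerateChains_le (G : SimpleGraph V) (n : ℕ) :
    degenerateChains G (n + 1) ≤ (degenerateChains G n).comap ((sing G).boundary n) := by
  refine Submodule.span_le.mpr ?_
  rintro _ ⟨σ, ⟨i, hi⟩, rfl⟩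
  simp only [Submodule.comap_coe, Set.mem_preimage, SetLike.mem_coe]
  rw [SemiCubicalSet.boundary_single]
  refine Submodule.sum_mem _ fun j _ => Submodule.smul_mem _ _ ?_
  by_cases hj : j = i
  · subst hj
    have : (sing G).face false j σ = (sing G).face true j σ := hi
    rw [this, sub_self]
    exact Submodule.zero_mem _
  · obtain ⟨k, rfl⟩ := (Fin.eq_self_or_eq_succAbove j i).resolve_left (Ne.symm hj)
    have key : ∀ b, Finsupp.single ((sing G).face b j σ) (1 : ℤ) ∈ degenerateChains G n := by
      intro b
      refine Submodule.subset_span ⟨_, ?_, rfl⟩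
      cases n with
      | zero => exact k.elim0
      | succ n =>
        refine ⟨k, ?_⟩
        have h1 := (sing G).face_face' false b j k σ
        have h2 := (sing G).face_face' true b j k σ
        refine h1.trans (Eq.trans ?_ h2.symm)
        exact congrArg _ hi
    exact Submodule.sub_mem _ (key _) (key _)

/-- The normalized singular cubical chains `C_*(G) = Q_*(G) / D_*(G)`. -/
noncomputable def cubicalChains (G : SimpleGraph V) : ChainComplex (ModuleCat.{u} ℤ) ℕ :=
  (sing G).quotientChains (degenerateChains G) (degenerateChains_le G)

/-- The discrete cubical homology `H_n(G)`. -/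
noncomputable abbrev cubicalHomology (G : SimpleGraph V) (n : ℕ) : ModuleCat.{u} ℤ :=
  (cubicalChains G).homology n

/-- Postcomposition with a graph map, on singular cubes. -/
def singMap {G : SimpleGraph V} {H : SimpleGraph W} (f : GraphMap G H) :
    (sing G).Hom (sing H) where
  app _ σ := f.comp σ
  app_face _ _ _ := rfl

/-- The chain map `C_*(G) → C_*(H)` induced by a graph map. -/
noncomputable def cubicalChainsMap {G : SimpleGraph V} {H : SimpleGraph W} (f : GraphMap G H) :
    cubicalChains G ⟶ cubicalChains H :=
  (singMap f).quotientMap _ _ _ _ (fun n => Submodule.span_le.mpr (by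
    rintro _ ⟨σ, hσ, rfl⟩
    simp only [Submodule.comap_coe, Set.mem_preimage, SetLike.mem_coe,
      Finsupp.lmapDomain_apply, Finsupp.mapDomain_single]
    refine Submodule.subset_span ⟨_, ?_, rfl⟩
    cases n with
    | zero => exact hσ
    | succ n =>
      obtain ⟨i, hi⟩ := hσ
      exact ⟨i, congrArg f.comp hi⟩))

/-! ## The CW complex obtained by filling in the cubes of a graph

`CW^□(G)` has one `n`-cell for each subgraph of `G` isomorphic to `I^n`, attached along its
faces.  An injective singular `n`-cube `σ` is a parametrization of such a subgraph, that is, a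
characteristic map of the cell; any two parametrizations of the same subgraph differ by an
automorphism of `I^n`, a composition of reflections `T_i` and transpositions `T_{i,j}` of
coordinates, each of which reverses the orientation of the cell.  So the cellular `n`-chains are
generated by the injective singular `n`-cubes, with `σ ∘ T_i = -σ` and `σ ∘ T_{i,j} = -σ`; this
is free abelian on the cells, after a choice of an orientation of each.  The cellular boundary of
a cell is the signed sum of its faces. -/

/-- The semi-cubical set of injective singular cubes of a graph. -/
def injSing (G : SimpleGraph V) : SemiCubicalSet.{u} where
  cells n := {σ : SingCube G n // Function.Injective σ.toFun}
  face b i σ := ⟨SingCube.face b i σ.1, fun _ _ h =>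
    (Fin.insertNth_injective2 (σ.2 h)).2⟩
  face_face a b i j hij σ := Subtype.ext ((sing G).face_face a b i j hij σ.1)

/-- `σ ∘ T_i` for an injective singular cube `σ`. -/
def injFlip {G : SimpleGraph V} {n : ℕ} (i : Fin n) (σ : (injSing G).cells n) :
    (injSing G).cells n :=
  ⟨SingCube.flip i σ.1, fun s t h => by
    have h' := σ.2 h
    funext m
    have hm := congrFun h' m
    by_cases hmi : m = i
    · subst hmi; simpa using hm
    · simpa [hmi] using hm⟩

/-- `σ ∘ T_π` for an injective singular cube `σ`. -/
def injPermute {G : SimpleGraph V} {n : ℕ} (π : Equiv.Perm (Fin n)) (σ : (injSing G).cells n) :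
    (injSing G).cells n :=
  ⟨SingCube.permute π σ.1, fun _ _ h => π.surjective.injective_comp_right (σ.2 h)⟩

/-- The subgroup of chains generated by `σ + σ ∘ T_i` and `σ + σ ∘ T_{i,j}`, `i ≠ j`. -/
noncomputable def orientationRelations (G : SimpleGraph V) (n : ℕ) :
    Submodule ℤ ((injSing G).cells n →₀ ℤ) :=
  Submodule.span ℤ
    ({x | ∃ (σ : (injSing G).cells n) (i : Fin n),
        x = Finsupp.single σ 1 + Finsupp.single (injFlip i σ) 1} ∪
      {x | ∃ (σ : (injSing G).cells n) (i j : Fin n), i ≠ j ∧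
        x = Finsupp.single σ 1 + Finsupp.single (injPermute (Equiv.swap i j) σ) 1})

section Orientation

variable {G : SimpleGraph V}

theorem face_injFlip_same {n : ℕ} (i : Fin (n + 1)) (b : Bool) (σ : (injSing G).cells (n + 1)) :
    (injSing G).face b i (injFlip i σ) = (injSing G).face (!b) i σ := by
  refine Subtype.ext (GraphMap.ext (funext fun t => congrArg σ.1.toFun ?_))
  simp

theorem face_injFlip_succAbove {n : ℕ} (j : Fin (n + 2)) (k : Fin (n + 1)) (b : Bool)
    (σ : (injSing G).cells (n + 2)) :
    (injSing G).face b j (injFlip (j.succAbove k) σ) =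
      injFlip k ((injSing G).face b j σ) := by
  refine Subtype.ext (GraphMap.ext (funext fun t => congrArg σ.1.toFun ?_))
  simp

theorem face_injPermute_succAbove {n : ℕ} (j : Fin (n + 1)) (k l : Fin n) (b : Bool)
    (σ : (injSing G).cells (n + 1)) :
    (injSing G).face b j (injPermute (Equiv.swap (j.succAbove k) (j.succAbove l)) σ) =
      injPermute (Equiv.swap k l) ((injSing G).face b j σ) := by
  refine Subtype.ext (GraphMap.ext (funext fun t => congrArg σ.1.toFun ?_))
  funext m
  rcases Fin.eq_self_or_eq_succAbove j m with rfl | ⟨m, rfl⟩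
  · simp [Equiv.swap_apply_of_ne_of_ne (Fin.succAbove_ne m k).symm (Fin.succAbove_ne m l).symm]
  · have : Equiv.swap (j.succAbove k) (j.succAbove l) (j.succAbove m) =
        j.succAbove (Equiv.swap k l m) :=
      (Fin.succAbove_right_injective.map_swap k l m).symm
    simp [this]

theorem face_injPermute_castSucc {n : ℕ} (k : Fin n) (b : Bool)
    (σ : (injSing G).cells (n + 1)) :
    (injSing G).face b k.castSucc (injPermute (Equiv.swap k.castSucc k.succ) σ) =
      (injSing G).face b k.succ σ := by
  refine Subtype.ext (GraphMap.ext (funext fun t => congrArg σ.1.toFun ?_))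
  refine Fin.eq_insertNth_iff.mpr ⟨by simp, funext fun m => ?_⟩
  rw [Fin.removeNth_apply, Function.comp_apply]
  have h : Equiv.swap k.castSucc k.succ (k.succ.succAbove m) = k.castSucc.succAbove m := by
    rcases lt_trichotomy m k with h | rfl | h
    · rw [Fin.succAbove_of_castSucc_lt _ _ (Fin.castSucc_lt_succ_iff.mpr h.le),
        Fin.succAbove_of_castSucc_lt _ _ (Fin.castSucc_lt_castSucc_iff.mpr h),
        Equiv.swap_apply_of_ne_of_ne]
      · exact (Fin.castSucc_lt_castSucc_iff.mpr h).ne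
      · exact (Fin.castSucc_lt_succ_iff.mpr h.le).ne
    · rw [Fin.succAbove_of_castSucc_lt _ _ (Fin.castSucc_lt_succ_iff.mpr le_rfl),
        Fin.succAbove_of_le_castSucc _ _ le_rfl, Equiv.swap_apply_left]
    · rw [Fin.succAbove_of_le_castSucc _ _ (Fin.succ_le_castSucc_iff.mpr h),
        Fin.succAbove_of_le_castSucc _ _ (Fin.castSucc_le_castSucc_iff.mpr h.le),
        Equiv.swap_apply_of_ne_of_ne]
      · exact (Fin.castSucc_lt_succ_iff.mpr h.le).ne'
      · exact (Fin.succ_lt_succ_iff.mpr h).ne'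
  rw [h, Fin.insertNth_apply_succAbove]

theorem injPermute_mul {n : ℕ} (π ρ : Equiv.Perm (Fin n)) (σ : (injSing G).cells n) :
    injPermute (π * ρ) σ = injPermute π (injPermute ρ σ) := rfl

theorem face_injPermute_succ {n : ℕ} (k : Fin n) (b : Bool)
    (σ : (injSing G).cells (n + 1)) :
    (injSing G).face b k.succ (injPermute (Equiv.swap k.castSucc k.succ) σ) =
      (injSing G).face b k.castSucc σ := by
  rw [← face_injPermute_castSucc, ← injPermute_mul, Equiv.swap_mul_self]
  rfl

theorem orientationRelations_le (G : SimpleGraph V) (n : ℕ) :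
    orientationRelations G (n + 1) ≤
      (orientationRelations G n).comap ((injSing G).boundary n) := by
  have hflip : ∀ (σ : (injSing G).cells n) (i : Fin n),
      Finsupp.single σ 1 + Finsupp.single (injFlip i σ) 1 ∈ orientationRelations G n :=
    fun σ i => Submodule.subset_span (Or.inl ⟨σ, i, rfl⟩)
  have hswap : ∀ (σ : (injSing G).cells n) (i j : Fin n), i ≠ j →
      Finsupp.single σ 1 + Finsupp.single (injPermute (Equiv.swap i j) σ) 1 ∈
        orientationRelations G n :=
    fun σ i j h => Submodule.subset_span (Or.inr ⟨σ, i, j, h, rfl⟩)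
  have hadj : ∀ (σ : (injSing G).cells (n + 1)) (k : Fin n),
      (injSing G).boundary n (Finsupp.single σ 1) + (injSing G).boundary n
        (Finsupp.single (injPermute (Equiv.swap k.castSucc k.succ) σ) 1) ∈
        orientationRelations G n := by
    intro σ k
    simp only [SemiCubicalSet.boundary_single, ← Finset.sum_add_distrib, ← smul_add]
    rw [← Finset.add_sum_erase _ _ (Finset.mem_univ k.castSucc),
      ← Finset.add_sum_erase _ _ (Finset.mem_erase.mpr
        ⟨(Fin.castSucc_lt_succ (i := k)).ne', Finset.mem_univ k.succ⟩), ← add_assoc]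
    refine Submodule.add_mem _ ?_ (Submodule.sum_mem _ fun j hj => Submodule.smul_mem _ _ ?_)
    · simp only [face_injPermute_castSucc, face_injPermute_succ]
      convert Submodule.zero_mem _
      simp only [Fin.val_castSucc, Fin.val_succ, pow_succ, mul_neg, mul_one, neg_smul, neg_neg]
      rw [add_comm (Finsupp.single ((injSing G).face false k.succ σ) (1 : ℤ) - _)]
      exact neg_add_cancel _
    · have h2 : k.succ ≠ j := fun h => (Finset.mem_erase.mp hj).1 h.symm
      have h1 : k.castSucc ≠ j :=
        fun h => (Finset.mem_erase.mp (Finset.mem_erase.mp hj).2).1 h.symm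
      obtain ⟨a, ha⟩ := (Fin.eq_self_or_eq_succAbove j k.castSucc).resolve_left h1
      obtain ⟨c, hc⟩ := (Fin.eq_self_or_eq_succAbove j k.succ).resolve_left h2
      have hac : a ≠ c := by
        rintro rfl
        exact (Fin.castSucc_lt_succ (i := k)).ne (ha.trans hc.symm)
      rw [ha, hc, face_injPermute_succAbove, face_injPermute_succAbove, sub_add_sub_comm]
      exact Submodule.sub_mem _ (hswap _ _ _ hac) (hswap _ _ _ hac)
  have hperm : ∀ (π : Equiv.Perm (Fin (n + 1))) (σ : (injSing G).cells (n + 1)),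
      (injSing G).boundary n (Finsupp.single (injPermute π σ) 1) -
        ((Equiv.Perm.sign π : ℤˣ) : ℤ) • (injSing G).boundary n (Finsupp.single σ 1) ∈
        orientationRelations G n := by
    intro π
    have hπ : π ∈ Submonoid.closure
        (Set.range fun i : Fin n => Equiv.swap i.castSucc i.succ) := by
      rw [Equiv.Perm.mclosure_swap_castSucc_succ]; trivial
    induction hπ using Submonoid.closure_induction with
    | mem π h =>
      obtain ⟨k, rfl⟩ := h
      intro σ
      have := hadj σ k
      rw [Equiv.Perm.sign_swap (Fin.castSucc_lt_succ (i := k)).ne]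
      simpa [add_comm] using this
    | one =>
      intro σ
      have : injPermute 1 σ = σ := rfl
      rw [this]; simp
    | mul π ρ _ _ h1 h2 =>
      intro σ
      have e1 := h1 (injPermute ρ σ)
      have e2 := Submodule.smul_mem _ ((Equiv.Perm.sign π : ℤˣ) : ℤ) (h2 σ)
      rw [injPermute_mul]
      convert Submodule.add_mem _ e1 e2 using 1
      rw [smul_sub, smul_smul, Equiv.Perm.sign_mul, Units.val_mul]
      abel
  refine Submodule.span_le.mpr (Set.union_subset ?_ ?_)
  · rintro _ ⟨σ, i, rfl⟩
    simp only [Submodule.comap_coe, Set.mem_preimage, SetLike.mem_coe, map_add]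
    simp only [SemiCubicalSet.boundary_single, ← Finset.sum_add_distrib, ← smul_add]
    refine Submodule.sum_mem _ fun j _ => Submodule.smul_mem _ _ ?_
    rcases Fin.eq_self_or_eq_succAbove j i with rfl | ⟨k, rfl⟩
    · rw [face_injFlip_same, face_injFlip_same]
      simp
    · cases n with
      | zero => exact k.elim0
      | succ n =>
        rw [face_injFlip_succAbove, face_injFlip_succAbove, sub_add_sub_comm]
        exact Submodule.sub_mem _ (hflip _ _) (hflip _ _)
  · rintro _ ⟨σ, i, j, hij, rfl⟩
    simp only [Submodule.comap_coe, Set.mem_preimage, SetLike.mem_coe, map_add]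
    have := hperm (Equiv.swap i j) σ
    rw [Equiv.Perm.sign_swap hij] at this
    simpa [add_comm] using this

end Orientation

/-- The cellular chain complex of `CW^□(G)`. -/
noncomputable def cellularChains (G : SimpleGraph V) : ChainComplex (ModuleCat.{u} ℤ) ℕ :=
  (injSing G).quotientChains (orientationRelations G) (orientationRelations_le G)

/-- The homology `H_n(CW^□(G))`. -/
noncomputable abbrev cellularHomology (G : SimpleGraph V) (n : ℕ) : ModuleCat.{u} ℤ :=
  (cellularChains G).homology n

/-- Postcomposition with an injective graph map, on injective singular cubes. -/
def injSingMap {G : SimpleGraph V} {H : SimpleGraph W} (f : GraphMap G H)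
    (hf : Function.Injective f.toFun) : (injSing G).Hom (injSing H) where
  app _ σ := ⟨f.comp σ.1, hf.comp σ.2⟩
  app_face _ _ _ := rfl

/-- The cellular chain map of the inclusion `CW^□(G) → CW^□(H)` induced by an injective graph
map `G → H`. -/
noncomputable def cellularChainsMap {G : SimpleGraph V} {H : SimpleGraph W} (f : GraphMap G H)
    (hf : Function.Injective f.toFun) : cellularChains G ⟶ cellularChains H :=
  (injSingMap f hf).quotientMap _ _ _ _ (fun n => Submodule.span_le.mpr (by
    rintro _ (⟨σ, i, rfl⟩ | ⟨σ, i, j, hij, rfl⟩)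
    · simp only [Submodule.comap_coe, Set.mem_preimage, SetLike.mem_coe, map_add,
        Finsupp.lmapDomain_apply, Finsupp.mapDomain_single]
      exact Submodule.subset_span (Or.inl ⟨(injSingMap f hf).app n σ, i, rfl⟩)
    · simp only [Submodule.comap_coe, Set.mem_preimage, SetLike.mem_coe, map_add,
        Finsupp.lmapDomain_apply, Finsupp.mapDomain_single]
      exact Submodule.subset_span (Or.inr ⟨(injSingMap f hf).app n σ, i, j, hij, rfl⟩)))

/-! ## Quasimonophobic graphs -/

/-- A subgraph isomorphic to the discrete `n`-cube. -/
def IsCube {G : SimpleGraph V} (n : ℕ) (Q : G.Subgraph) : Prop :=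
  Nonempty (cubeGraph n ≃g Q.coe)

/-- `Q` is quasimonophobic if whenever a noninjective singular `(n+1)`-cube has a face with
image `Q`, it has at least one additional face with image `Q`. -/
def IsQuasimonophobicCube {G : SimpleGraph V} (n : ℕ) (Q : G.Subgraph) : Prop :=
  ∀ σ : SingCube G (n + 1), ¬ Function.Injective σ.toFun →
    ∀ (b : Bool) (i : Fin (n + 1)), (SingCube.face b i σ).image = Q →
      ∃ (c : Bool) (j : Fin (n + 1)), (c, j) ≠ (b, i) ∧ (SingCube.face c j σ).image = Q

/-- A graph is `n`-quasimonophobic if every `n`-cube in it is rigid (an induced subgraph) and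
quasimonophobic. -/
def IsQuasimonophobic (G : SimpleGraph V) (n : ℕ) : Prop :=
  ∀ Q : G.Subgraph, IsCube n Q → Q.IsInduced ∧ IsQuasimonophobicCube n Q

/-! ## Regular semi-cubical sets and their 1-skeleton graphs -/

namespace SemiCubicalSet

variable (X : SemiCubicalSet.{u})

/-- The disjoint union of the solid cubes `[0,1]^n`, one for each `n`-cell. -/
abbrev CellPoint : Type u := Σ c : (Σ n, X.cells n), (Fin c.1 → unitInterval)

/-- The gluing relation of the geometric realization: the solid cube of a face of `c` is glued
to the corresponding face of the solid cube of `c`. -/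
inductive Glue : X.CellPoint → X.CellPoint → Prop
  | mk {n : ℕ} (b : Bool) (i : Fin (n + 1)) (c : X.cells (n + 1)) (t : Fin n → unitInterval) :
      Glue ⟨⟨n, X.face b i c⟩, t⟩ ⟨⟨n + 1, c⟩, i.insertNth (if b then 1 else 0) t⟩

/-- The geometric realization `|X|`, a quotient of the disjoint union of solid cubes, with the
quotient topology. -/
abbrev Realization : Type u := Quot X.Glue

/-- The characteristic map `[0,1]^n → |X|` of an `n`-cell. -/
def charMap {n : ℕ} (c : X.cells n) (t : Fin n → unitInterval) : X.Realization :=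
  Quot.mk _ ⟨⟨n, c⟩, t⟩

/-- `X` is regular if all characteristic maps of its geometric realization are injective. -/
def IsRegular : Prop :=
  ∀ (n : ℕ) (c : X.cells n), Function.Injective (X.charMap c)

/-- The vertex of an `n`-cell in the corner `t` of the `n`-cube. -/
def vertex : {n : ℕ} → X.cells n → (Fin n → Bool) → X.cells 0
  | 0, c, _ => c
  | _ + 1, c, t => vertex (X.face (t 0) 0 c) (Fin.tail t)

/-- The graph `G(X)` given by the 1-skeleton of `X`: its vertices are the `0`-cells, and two
distinct vertices are adjacent if they are the two ends of some `1`-cell. -/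
def graph : SimpleGraph (X.cells 0) where
  Adj v w := v ≠ w ∧ ∃ e : X.cells 1,
    (X.face false 0 e = v ∧ X.face true 0 e = w) ∨ (X.face false 0 e = w ∧ X.face true 0 e = v)
  symm := ⟨fun _ _ ⟨h, e, he⟩ => ⟨h.symm, e, he.symm⟩⟩
  loopless := ⟨fun _ h => h.1 rfl⟩

theorem vertex_face : {n : ℕ} → (b : Bool) → (i : Fin (n + 1)) → (c : X.cells (n + 1)) →
    (t : Fin n → Bool) → X.vertex (X.face b i c) t = X.vertex c (i.insertNth b t)
  | 0, b, i, c, t => by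
    obtain rfl : i = 0 := Fin.fin_one_eq_zero i
    simp [vertex]
  | n + 1, b, i, c, t => by
    refine Fin.cases ?_ (fun j => ?_) i
    · simp [vertex]
    · have h1 : (Fin.insertNth j.succ b t : Fin (n + 2) → Bool) =
          Fin.cons (t 0) (Fin.insertNth j b (Fin.tail t)) := by
        conv_lhs => rw [← Fin.cons_self_tail t]
        exact Fin.insertNth_succ_cons _ _ _ _
      rw [h1]
      change X.vertex (X.face (t 0) 0 (X.face b j.succ c)) (Fin.tail t) =
        X.vertex (X.face (t 0) 0 c) (Fin.insertNth j b (Fin.tail t))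
      have h2 := X.face_face (t 0) b 0 j (Fin.zero_le j) c
      rw [Fin.castSucc_zero] at h2
      rw [h2, vertex_face]

theorem vertex_adj : {n : ℕ} → (c : X.cells n) → (s t : Fin n → Bool) →
    (cubeGraph n).Adj s t → X.graph.Adj (X.vertex c s) (X.vertex c t) ∨ X.vertex c s = X.vertex c t
  | 0, c, s, t, h => Or.inr rfl
  | 1, c, s, t, h => by
    by_cases hv : X.vertex c s = X.vertex c t
    · exact Or.inr hv
    · refine Or.inl ⟨hv, c, ?_⟩
      obtain ⟨i, hi, -⟩ := h
      obtain rfl : i = 0 := Subsingleton.elim _ _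
      simp only [vertex]
      cases hs : s 0 <;> cases ht : t 0 <;> simp_all
  | n + 2, c, s, t, h => by
    obtain ⟨i, hi, hu⟩ := h
    obtain ⟨j, hj⟩ := exists_ne i
    have hst : s j = t j := by
      by_contra hne
      exact hj (hu j hne)
    have hs := X.vertex_face (s j) j c (j.removeNth s)
    have ht := X.vertex_face (t j) j c (j.removeNth t)
    rw [Fin.insertNth_self_removeNth] at hs ht
    rw [← hs, ← ht, ← hst]
    refine vertex_adj _ _ _ ?_
    obtain ⟨k, rfl⟩ := (Fin.eq_self_or_eq_succAbove j i).resolve_left hj.symm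
    exact ⟨k, hi, fun m hm => Fin.succAbove_right_injective (hu _ hm)⟩

theorem charMap_corner : {n : ℕ} → (c : X.cells n) → (t : Fin n → Bool) →
    X.charMap c (fun i => if t i then 1 else 0) = X.charMap (X.vertex c t) Fin.elim0
  | 0, c, t => congrArg _ (Subsingleton.elim _ _)
  | n + 1, c, t => by
    have h := Quot.sound (Glue.mk (t 0) 0 c (fun i => if Fin.tail t i then 1 else 0))
    have h2 : (Fin.insertNth 0 (if t 0 then 1 else 0) (fun i => if Fin.tail t i then 1 else 0) :
        Fin (n + 1) → unitInterval) = fun i => if t i then 1 else 0 := by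
      rw [Fin.insertNth_eq_iff]
      exact ⟨rfl, rfl⟩
    rw [h2] at h
    exact h.symm.trans (charMap_corner _ _)

theorem IsRegular.vertex_injective {X : SemiCubicalSet.{u}} (hX : X.IsRegular) {n : ℕ}
    (c : X.cells n) : Function.Injective (X.vertex c) := by
  intro s t h
  have h1 := X.charMap_corner c s
  rw [h, ← X.charMap_corner c t] at h1
  have h2 := hX n c h1
  funext i
  have h3 := congrFun h2 i
  cases hs : s i <;> cases ht : t i <;> simp_all

/-- An `n`-cell `σ` of `X` as a singular `n`-cube `I^n → G(X)`. -/
def toSing : X.Hom (sing X.graph) where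
  app _ c := ⟨X.vertex c, X.vertex_adj c⟩
  app_face b i c := GraphMap.ext (funext fun t => X.vertex_face b i c t)

/-- The singular cubes of the cells of a regular semi-cubical set are injective. -/
def toInjSing (hX : X.IsRegular) : X.Hom (injSing X.graph) where
  app _ c := ⟨X.toSing.app _ c, hX.vertex_injective c⟩
  app_face b i c := Subtype.ext (X.toSing.app_face b i c)

/-- The class `[x]_graph ∈ H_n(G(X))` of a cycle `x` of `X`. -/
noncomputable def graphClass {n : ℕ} (x : X.chains.X n) (hx : IsCycle X.chains x) :
    cubicalHomology X.graph n :=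
  HomologicalComplex.homologyMap
    (X.toSing.toQuotientChains (degenerateChains X.graph) (degenerateChains_le X.graph)) n
    (cycleClass X.chains x hx)

/-- The class `[x]_CW ∈ H_n(CW^□(G(X)))` of a cycle `x` of a regular `X`: the image of the class
of `x` under the cellular map `|X| → CW^□(G(X))` that carries each cell `σ` of `X` to the cell
of the cube subgraph formed by the vertices and the edges of `σ`. -/
noncomputable def cwClass (hX : X.IsRegular) {n : ℕ} (x : X.chains.X n)
    (hx : IsCycle X.chains x) : cellularHomology X.graph n :=
  HomologicalComplex.homologyMap ((X.toInjSing hX).toQuotientChains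
    (orientationRelations X.graph) (orientationRelations_le X.graph)) n
    (cycleClass X.chains x hx)

end SemiCubicalSet

end DiscreteCubical

/-! Send an injective singular cube of `G` to its cell in `CW^□(G)` and every other singular cube to
zero (`toCellular`). Degenerate cubes go to zero. If this map commutes with the boundary from degree
`n + 1` to degree `n`, then a chain of injective cubes that bounds among singular chains modulo
degenerate ones also bounds among cellular chains. Since `X` is regular and `α` injective, `α_* x`
is such a chain and represents both classes, so the theorem follows by contraposition.

What must be shown is that the injective faces of a noninjective `(n+1)`-cube `τ` cancel as oriented
cells (`sum_signedFace_eq_zero`). Group them by their image `Q`; quasimonophobia gives at least two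
faces in each nonempty group. Faces onto `Q` in two different directions are identified by the
obvious swap, which reverses orientation, so they cancel (`FaceOnto.signedFace_add`). At most two
directions can occur (`FaceOnto.not_three`), and if one of them contributes both of its faces, so
does the other (`FaceOnto.opposite`).

There remains the case of two opposite faces alone. They differ by an automorphism of the cube,
which moves each vertex by at most one edge because `Q` is induced. Such an automorphism is the
identity, a reflection or a quarter turn (`cubeMap_trichotomy`). A reflection would force a face
onto `Q` in another direction (`FaceOnto.of_flipAt`); the other two preserve orientation, so the
opposite boundary signs make the faces cancel. -/

namespace DiscreteCubical

/-! ## Vertices of the cube and their neighbours -/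

/-- The neighbour of a vertex of the cube in the direction `i`. -/
def flipAt {n : ℕ} (i : Fin n) (s : Fin n → Bool) : Fin n → Bool :=
  Function.update s i (!(s i))

section FlipAt

variable {n : ℕ}

theorem flipAt_apply (i : Fin n) (s : Fin n → Bool) (m : Fin n) :
    flipAt i s m = if m = i then !(s m) else s m := by
  unfold flipAt
  by_cases h : m = i
  · subst h; simp
  · simp [h]

@[simp] theorem flipAt_same (i : Fin n) (s : Fin n → Bool) : flipAt i s i = !(s i) := by
  simp [flipAt_apply]

theorem flipAt_of_ne {i m : Fin n} (h : m ≠ i) (s : Fin n → Bool) : flipAt i s m = s m := by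
  simp [flipAt_apply, h]

@[simp] theorem flipAt_flipAt (i : Fin n) (s : Fin n → Bool) : flipAt i (flipAt i s) = s := by
  funext m
  by_cases h : m = i <;> simp [flipAt_apply, h]

theorem flipAt_comm (i j : Fin n) (s : Fin n → Bool) :
    flipAt i (flipAt j s) = flipAt j (flipAt i s) := by
  funext m
  simp only [flipAt_apply]
  split_ifs <;> rfl

theorem flipAt_right_inj {i j : Fin n} {s : Fin n → Bool} : flipAt i s = flipAt j s ↔ i = j := by
  refine ⟨fun h => ?_, fun h => h ▸ rfl⟩
  by_contra hij
  have := congrFun h i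
  simp [flipAt_apply, hij] at this

theorem flipAt_ne (i : Fin n) (s : Fin n → Bool) : flipAt i s ≠ s := by
  intro h
  have := congrFun h i
  simp at this

theorem flipAt_injective (i : Fin n) : Function.Injective (flipAt i) :=
  Function.LeftInverse.injective (flipAt_flipAt i)

/-- Parity: two flips change the number of `true` coordinates by an even amount, one flip by an odd
amount. -/
theorem flipAt_flipAt_ne_flipAt (a b c : Fin n) (s : Fin n → Bool) :
    flipAt a (flipAt b s) ≠ flipAt c s := by
  intro h
  have ha := congrFun h a
  have hb := congrFun h b
  have hc := congrFun h c
  simp only [flipAt_apply] at ha hb hc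
  grind

/-- Two flips change exactly the symmetric difference of `{a}` and `{b}`, so either both sides are
`s` or the unordered pairs agree. -/
theorem flipAt_flipAt_eq_iff {a b c d : Fin n} {s : Fin n → Bool}
    (h : flipAt a (flipAt b s) = flipAt c (flipAt d s)) :
    (a = b ∧ c = d) ∨ (a = c ∧ b = d) ∨ (a = d ∧ b = c) := by
  have ha := congrFun h a
  have hb := congrFun h b
  have hc := congrFun h c
  have hd := congrFun h d
  simp only [flipAt_apply] at ha hb hc hd
  grind

theorem cubeGraph_adj_iff {s t : Fin n → Bool} :
    (cubeGraph n).Adj s t ↔ ∃ i, t = flipAt i s := by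
  constructor
  · rintro ⟨i, hi, hu⟩
    refine ⟨i, funext fun m => ?_⟩
    rw [flipAt_apply]
    split_ifs with h
    · subst h
      revert hi
      cases s m <;> cases t m <;> simp
    · by_contra hm
      exact h (hu m (Ne.symm hm))
  · rintro ⟨i, rfl⟩
    refine ⟨i, by simp, fun m hm => ?_⟩
    by_contra h
    exact hm (flipAt_of_ne h s).symm

theorem cubeGraph_adj_flipAt (i : Fin n) (s : Fin n → Bool) :
    (cubeGraph n).Adj s (flipAt i s) := cubeGraph_adj_iff.mpr ⟨i, rfl⟩

/-- A property that is closed under passing to neighbours and holds at one vertex holds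
everywhere. -/
theorem flipAt_induction {p : (Fin n → Bool) → Prop} (s : Fin n → Bool) (hs : p s)
    (h : ∀ i s, p s → p (flipAt i s)) (t : Fin n → Bool) : p t := by
  -- Overwriting `s` by `t` on a growing set `A` of coordinates gives a path from `s` to `t`.
  have key : ∀ A : Finset (Fin n), p (fun i => if i ∈ A then t i else s i) := by
    intro A
    induction A using Finset.induction_on with
    | empty => simpa using hs
    | insert a A ha ih =>
      by_cases hts : t a = s a
      · convert ih using 2 with i
        by_cases hi : i = a
        · subst hi; simp [ha, hts]
        · simp [hi]
      · convert h a _ ih using 1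
        funext i
        rw [flipAt_apply]
        by_cases hi : i = a
        · subst hi
          simp only [Finset.mem_insert_self, if_true, ha, if_false]
          revert hts
          cases t i <;> cases s i <;> simp
        · simp [hi]
  simpa using key Finset.univ

theorem insertNth_flipAt (i : Fin (n + 1)) (b : Bool) (k : Fin n) (t : Fin n → Bool) :
    (i.insertNth b (flipAt k t) : Fin (n + 1) → Bool) =
      flipAt (i.succAbove k) (i.insertNth b t) := by
  funext m
  rcases Fin.eq_self_or_eq_succAbove i m with rfl | ⟨m, rfl⟩
  · simp [flipAt_apply, (Fin.succAbove_ne m k).symm]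
  · simp [flipAt_apply]

theorem flipAt_insertNth (i : Fin (n + 1)) (b : Bool) (t : Fin n → Bool) :
    flipAt i (i.insertNth b t) = i.insertNth (!b) t := by
  funext m
  rcases Fin.eq_self_or_eq_succAbove i m with rfl | ⟨m, rfl⟩
  · simp
  · simp [flipAt_apply]

end FlipAt

/-! ## Injective maps of the cube to itself -/

section CubeMaps

variable {n : ℕ}

theorem SingCube.adj_of_injective {V : Type u} {G : SimpleGraph V} {σ : SingCube G n}
    (hσ : Function.Injective σ.toFun) {s t : Fin n → Bool} (h : (cubeGraph n).Adj s t) :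
    G.Adj (σ.toFun s) (σ.toFun t) :=
  (σ.map_adj s t h).resolve_right fun h' => h.ne (hσ h')

theorem exists_flipAt_of_injective {g : SingCube (cubeGraph n) n}
    (hg : Function.Injective g.toFun) (k : Fin n) (s : Fin n → Bool) :
    ∃ l, g.toFun (flipAt k s) = flipAt l (g.toFun s) :=
  cubeGraph_adj_iff.mp (SingCube.adj_of_injective hg (cubeGraph_adj_flipAt k s))

/-- Injective self-maps of the cube that agree on a vertex and all its neighbours are equal. -/
theorem cubeMap_eq_of_agree {f g : SingCube (cubeGraph n) n}
    (hf : Function.Injective f.toFun) (hg : Function.Injective g.toFun) (s : Fin n → Bool)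
    (h0 : f.toFun s = g.toFun s) (h1 : ∀ m, f.toFun (flipAt m s) = g.toFun (flipAt m s)) :
    f.toFun = g.toFun := by
  refine funext fun t => (flipAt_induction
    (p := fun t => f.toFun t = g.toFun t ∧ ∀ m, f.toFun (flipAt m t) = g.toFun (flipAt m t))
    s ⟨h0, h1⟩ ?_ t).1
  rintro m t ⟨e0, e1⟩
  refine ⟨e1 m, fun l => ?_⟩
  by_cases hl : l = m
  · subst hl; simpa using e0
  -- Two vertices at distance two have exactly two common neighbours. So in each square at `t` the
  -- image of the far corner is forced: it is the common neighbour other than `h.toFun t`.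
  have key : ∀ h : SingCube (cubeGraph n) n, Function.Injective h.toFun → ∀ a b,
      h.toFun (flipAt m t) = flipAt a (h.toFun t) → h.toFun (flipAt l t) = flipAt b (h.toFun t) →
      h.toFun (flipAt l (flipAt m t)) = flipAt b (flipAt a (h.toFun t)) := by
    intro h hh a b ha hb
    obtain ⟨c, hc⟩ := exists_flipAt_of_injective hh l (flipAt m t)
    obtain ⟨d, hd⟩ := exists_flipAt_of_injective hh m (flipAt l t)
    rw [flipAt_comm, hc, ha, hb] at hd
    rw [hc, ha]
    rcases flipAt_flipAt_eq_iff hd with ⟨rfl, -⟩ | ⟨-, rfl⟩ | ⟨rfl, -⟩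
    · rw [ha, flipAt_flipAt] at hc
      have := congrArg (flipAt l) (hh hc)
      rw [flipAt_flipAt] at this
      exact absurd (flipAt_right_inj.mp this) (Ne.symm hl)
    · exact absurd (flipAt_right_inj.mp (hh (hb.trans ha.symm))) hl
    · rfl
  obtain ⟨a, ha⟩ := exists_flipAt_of_injective hf m t
  obtain ⟨b, hb⟩ := exists_flipAt_of_injective hf l t
  rw [key f hf a b ha hb, key g hg a b (by rw [← e1, ha, e0]) (by rw [← e1, hb, e0]), e0]

/-- An injective self-map of the cube that moves every vertex by at most one edge is the
identity, a reflection, or a quarter turn. -/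
theorem cubeMap_trichotomy {g : SingCube (cubeGraph n) n} (hg : Function.Injective g.toFun)
    (hd : ∀ s, g.toFun s = s ∨ ∃ d, g.toFun s = flipAt d s) :
    (∀ s, g.toFun s = s) ∨ (∃ k, ∀ s, g.toFun s = flipAt k s) ∨
      ∃ k a c, k ≠ a ∧ ∀ s, g.toFun s = flipAt c (s ∘ Equiv.swap k a) := by
  let one : SingCube (cubeGraph n) n := ⟨id, fun _ _ h => Or.inl h⟩
  have hone : Function.Injective one.toFun := fun _ _ h => h
  -- A constant base vertex is fixed by every permutation of coordinates, which makes the values of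
  -- a quarter turn near it easy to compute.
  let y : Fin n → Bool := fun _ => false
  rcases hd y with hy | ⟨k, hk⟩
  · left
    refine congrFun (cubeMap_eq_of_agree hg hone y hy fun m => ?_)
    obtain ⟨l, hl⟩ := exists_flipAt_of_injective hg m y
    rw [hy] at hl
    rcases hd (flipAt m y) with h | ⟨d, h⟩
    · exact h
    · exact absurd (h.symm.trans hl) (flipAt_flipAt_ne_flipAt _ _ _ _)
  · right
    -- the neighbours in the other directions
    have hm : ∀ m, m ≠ k → g.toFun (flipAt m y) = y ∨
        g.toFun (flipAt m y) = flipAt k (flipAt m y) := by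
      intro m hmk
      obtain ⟨l, hl⟩ := exists_flipAt_of_injective hg m y
      rw [hk] at hl
      rcases hd (flipAt m y) with h | ⟨d, h⟩
      · exact absurd (hl.symm.trans h) (flipAt_flipAt_ne_flipAt _ _ _ _)
      · rcases flipAt_flipAt_eq_iff (h.symm.trans hl) with ⟨rfl, -⟩ | ⟨-, rfl⟩ | ⟨rfl, -⟩
        · left; rw [h, flipAt_flipAt]
        · exact absurd rfl hmk
        · right; exact h
    obtain ⟨a, ha⟩ := exists_flipAt_of_injective hg k y
    rw [hk] at ha
    -- If `a = k`, then `g` exchanges `y` and its `k`-th neighbour: a reflection. Otherwise `g`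
    -- carries `y` to `flipAt k y` and that on to the far corner of the `k`,`a` square: a quarter
    -- turn of this square.
    by_cases hak : a = k
    · subst hak
      rw [flipAt_flipAt] at ha
      refine Or.inl ⟨a, congrFun (cubeMap_eq_of_agree (g := SingCube.flip a one) hg
        (flipAt_injective a) y hk fun m => ?_)⟩
      by_cases hma : m = a
      · subst hma
        exact ha.trans (flipAt_flipAt m y).symm
      · refine (hm m hma).resolve_left fun h => hma ?_
        exact flipAt_right_inj.mp (hg (h.trans ha.symm))
    · refine Or.inr ⟨k, a, k, Ne.symm hak, congrFun (cubeMap_eq_of_agree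
        (g := SingCube.permute (Equiv.swap k a) (SingCube.flip k one)) hg
        (fun s t h => (Equiv.swap k a).surjective.injective_comp_right (flipAt_injective k h))
        y hk fun m => ?_)⟩
      change _ = flipAt k (flipAt m y ∘ Equiv.swap k a)
      have hsw : flipAt m y ∘ Equiv.swap k a = flipAt (Equiv.swap k a m) y := by
        funext i
        simp [flipAt_apply, y, Equiv.swap_apply_eq_iff]
      rw [hsw]
      by_cases hmk : m = k
      · subst hmk
        rw [ha, Equiv.swap_apply_left, flipAt_comm]
      by_cases hma : m = a
      · subst hma
        rw [Equiv.swap_apply_right, flipAt_flipAt]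
        refine (hm m hmk).resolve_right fun h => hmk ?_
        exact flipAt_right_inj.mp (hg (h.trans (flipAt_comm k m y |>.trans ha.symm)))
      · rw [Equiv.swap_apply_of_ne_of_ne hmk hma]
        -- If `flipAt m y` went to `y`, then the corner `flipAt k (flipAt m y)` would go to a common
        -- neighbour of `y` and `flipAt a (flipAt k y)`. Of the two candidates, `flipAt k y` is
        -- already the image of `y`, and `flipAt a y` is three edges away from the corner.
        refine (hm m hmk).resolve_left fun h => ?_
        obtain ⟨c, hc⟩ := exists_flipAt_of_injective hg k (flipAt m y)
        obtain ⟨e, he⟩ := exists_flipAt_of_injective hg m (flipAt k y)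
        rw [flipAt_comm, hc, h, ha] at he
        rw [h] at hc
        have he' := congrArg (flipAt e) he
        rw [flipAt_flipAt] at he'
        have hck : c = k ∨ c = a := by
          rcases flipAt_flipAt_eq_iff he' with ⟨-, h2⟩ | ⟨-, h2⟩ | ⟨-, h2⟩
          · exact absurd h2 hak
          · exact Or.inl h2
          · exact Or.inr h2
        rcases hd (flipAt k (flipAt m y)) with h' | ⟨d, h'⟩
        · exact flipAt_flipAt_ne_flipAt _ _ _ _ (h'.symm.trans hc)
        · have h3 := congrArg (flipAt d) (h'.symm.trans hc)
          rw [flipAt_flipAt] at h3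
          rcases flipAt_flipAt_eq_iff h3 with ⟨h4, -⟩ | ⟨-, h4⟩ | ⟨h4, -⟩
          · exact hmk h4.symm
          · rcases hck with h5 | h5
            · exact hmk (h4.trans h5)
            · exact hma (h4.trans h5)
          · subst h4
            have h6 := congrArg (flipAt k) (hg (hc.trans hk.symm))
            rw [flipAt_flipAt] at h6
            exact hmk (flipAt_right_inj.mp h6)

end CubeMaps

/-! ## Images of singular cubes -/

section Image

variable {V : Type u} {G : SimpleGraph V} {n : ℕ}

theorem image_eq_of_comp_equiv {σ τ : SingCube G n} (e : (Fin n → Bool) ≃ (Fin n → Bool))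
    (he : ∀ s t, (cubeGraph n).Adj (e s) (e t) ↔ (cubeGraph n).Adj s t)
    (h : ∀ s, τ.toFun s = σ.toFun (e s)) : τ.image = σ.image := by
  refine SimpleGraph.Subgraph.ext ?_ ?_
  · ext v
    simp only [GraphMap.image, Set.mem_range, h]
    exact (e.surjective.exists (p := fun s => σ.toFun s = v)).symm
  · ext v w
    simp only [GraphMap.image, h]
    refine and_congr_right fun _ => ?_
    constructor
    · rintro ⟨s, t, hst, hs, ht⟩
      exact ⟨e s, e t, (he s t).mpr hst, hs, ht⟩
    · rintro ⟨s, t, hst, hs, ht⟩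
      refine ⟨e.symm s, e.symm t, (he _ _).mp (by simpa using hst), by simpa using hs,
        by simpa using ht⟩

theorem image_flip (i : Fin n) (σ : SingCube G n) : (SingCube.flip i σ).image = σ.image := by
  refine image_eq_of_comp_equiv (Function.Involutive.toPerm _ (flipAt_flipAt i)) ?_ fun s => rfl
  intro s t
  change (cubeGraph n).Adj (flipAt i s) (flipAt i t) ↔ _
  simp only [cubeGraph_adj_iff]
  refine exists_congr fun k => ?_
  rw [flipAt_comm, (flipAt_injective i).eq_iff]

theorem image_permute (π : Equiv.Perm (Fin n)) (σ : SingCube G n) :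
    (SingCube.permute π σ).image = σ.image := by
  refine image_eq_of_comp_equiv (Equiv.arrowCongr π.symm (Equiv.refl Bool)) ?_ fun s => rfl
  intro s t
  simp only [cubeGraph]
  refine ⟨?_, ?_⟩
  · rintro ⟨k, hk, hu⟩
    refine ⟨π k, hk, fun m hm => ?_⟩
    rw [← hu (π.symm m) (by simpa using hm), Equiv.apply_symm_apply]
  · rintro ⟨k, hk, hu⟩
    refine ⟨π.symm k, by simpa using hk, fun m hm => ?_⟩
    rw [← hu (π m) (by simpa using hm), Equiv.symm_apply_apply]

theorem injective_flip_iff (i : Fin n) (σ : SingCube G n) :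
    Function.Injective (SingCube.flip i σ).toFun ↔ Function.Injective σ.toFun :=
  Function.Injective.of_comp_iff' σ.toFun
    (Function.Involutive.bijective (f := flipAt i) (flipAt_flipAt i))

theorem injective_permute_iff (π : Equiv.Perm (Fin n)) (σ : SingCube G n) :
    Function.Injective (SingCube.permute π σ).toFun ↔ Function.Injective σ.toFun :=
  Function.Injective.of_comp_iff' σ.toFun
    (Equiv.arrowCongr π.symm (Equiv.refl Bool)).bijective

/-- Counting: `τ` reaches all `2^n` vertices of the image, so it cannot repeat any. This makes the
further face supplied by quasimonophobia injective. -/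
theorem injective_of_image_eq {σ τ : SingCube G n} (hσ : Function.Injective σ.toFun)
    (h : τ.image = σ.image) : Function.Injective τ.toFun := by
  have hr : Set.range τ.toFun = Set.range σ.toFun := congrArg SimpleGraph.Subgraph.verts h
  have hc : ∀ s, ∃ t, σ.toFun t = τ.toFun s := fun s => by
    have : τ.toFun s ∈ Set.range σ.toFun := hr ▸ ⟨s, rfl⟩
    exact this
  choose e he using hc
  have hsurj : Function.Surjective e := fun t => by
    have : σ.toFun t ∈ Set.range τ.toFun := hr ▸ ⟨t, rfl⟩
    obtain ⟨s, hs⟩ := this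
    exact ⟨s, hσ ((he s).trans hs)⟩
  intro s s' hss
  refine (Finite.injective_iff_surjective.mpr hsurj) (hσ ?_)
  rw [he, he, hss]

theorem isCube_image {σ : SingCube G n} (hσ : Function.Injective σ.toFun) :
    IsCube n σ.image := by
  refine ⟨⟨Equiv.ofInjective σ.toFun hσ, ?_⟩⟩
  intro s t
  constructor
  · rintro ⟨-, v, w, hvw, hv, hw⟩
    rwa [hσ hv, hσ hw] at hvw
  · intro h
    exact ⟨SingCube.adj_of_injective hσ h, s, t, h, rfl, rfl⟩

end Image

/-! ## Faces with a common image -/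

/-- The face `f_i^b` of a singular cube is injective with image `Q`. -/
def FaceOnto {V : Type u} {G : SimpleGraph V} {n : ℕ} (τ : SingCube G (n + 1)) (Q : G.Subgraph)
    (b : Bool) (i : Fin (n + 1)) : Prop :=
  Function.Injective (SingCube.face b i τ).toFun ∧ (SingCube.face b i τ).image = Q

section FaceOnto

variable {V : Type u} {G : SimpleGraph V} {n : ℕ} {τ : SingCube G (n + 1)} {Q : G.Subgraph}

theorem FaceOnto.inj {b : Bool} {i : Fin (n + 1)} (h : FaceOnto τ Q b i)
    {s t : Fin (n + 1) → Bool} (hs : s i = b) (ht : t i = b) (hst : τ.toFun s = τ.toFun t) :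
    s = t := by
  rw [← Fin.insertNth_self_removeNth i s, ← Fin.insertNth_self_removeNth i t, hs, ht] at hst ⊢
  rw [h.1 hst]

/-- Describes the edges of `Q` in the coordinates of the ambient `(n+1)`-cube, so that faces in
different directions can be compared. -/
theorem FaceOnto.adj_iff {b : Bool} {i : Fin (n + 1)} (h : FaceOnto τ Q b i) {v w : V} :
    Q.Adj v w ↔ ∃ s m, s i = b ∧ m ≠ i ∧ τ.toFun s = v ∧ τ.toFun (flipAt m s) = w := by
  rw [← h.2]
  constructor
  · rintro ⟨-, s, t, hst, rfl, rfl⟩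
    obtain ⟨k, rfl⟩ := cubeGraph_adj_iff.mp hst
    refine ⟨i.insertNth b s, i.succAbove k, by simp, Fin.succAbove_ne i k, rfl, ?_⟩
    rw [← insertNth_flipAt]; rfl
  · rintro ⟨s, m, rfl, hm, rfl, rfl⟩
    obtain ⟨k, rfl⟩ := (Fin.eq_self_or_eq_succAbove i m).resolve_left hm
    have e1 : τ.toFun s = (SingCube.face (s i) i τ).toFun (i.removeNth s) := by
      simp [SingCube.face]
    have e2 : τ.toFun (flipAt (i.succAbove k) s) =
        (SingCube.face (s i) i τ).toFun (flipAt k (i.removeNth s)) := by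
      simp [SingCube.face, insertNth_flipAt]
    rw [e1, e2]
    exact ⟨SingCube.adj_of_injective h.1 (cubeGraph_adj_flipAt k _), _, _,
      cubeGraph_adj_flipAt k _, rfl, rfl⟩

/-- Two adjacent faces with the same image are identified by the evident isomorphism between
them. -/
theorem FaceOnto.toFun_flipAt {a b : Bool} {i j : Fin (n + 1)} (hij : i ≠ j)
    (hi : FaceOnto τ Q a i) (hj : FaceOnto τ Q b j) {s : Fin (n + 1) → Bool} (hsi : s i = a)
    (hsj : s j = b) : τ.toFun (flipAt i s) = τ.toFun (flipAt j s) := by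
  -- The edge at `s` in direction `i` lies in the `j`-face, so it maps to an edge of `Q`, which must
  -- also come from an edge of the `i`-face at `s`. Injectivity on the `j`-face leaves only
  -- direction `j` for the latter.
  obtain ⟨v, m, hv, hm, hvs, hw⟩ := hi.adj_iff.mp (hj.adj_iff.mpr ⟨s, i, hsj, hij, rfl, rfl⟩)
  obtain rfl := hi.inj hv hsi hvs
  by_cases hmj : m = j
  · rw [← hw, hmj]
  · have := hj.inj ((flipAt_of_ne (Ne.symm hmj) v).trans hsj)
      ((flipAt_of_ne (Ne.symm hij) v).trans hsj) hw
    exact absurd (flipAt_right_inj.mp this) hm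

/-- At a vertex common to the three faces, the neighbours in directions `i`, `j`, `k` all have the
same value under `τ`; but the last two lie in the `i`-face, where `τ` is injective. -/
theorem FaceOnto.not_three {a b c : Bool} {i j k : Fin (n + 1)} (hij : i ≠ j) (hik : i ≠ k)
    (hjk : j ≠ k) (hi : FaceOnto τ Q a i) (hj : FaceOnto τ Q b j) (hk : FaceOnto τ Q c k) :
    False := by
  let s : Fin (n + 1) → Bool := fun m => if m = i then a else if m = j then b else c
  have hsi : s i = a := by simp [s]
  have hsj : s j = b := by simp [s, hij.symm]
  have hsk : s k = c := by simp [s, hik.symm, hjk.symm]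
  have h1 := hi.toFun_flipAt hij hj hsi hsj
  have h2 := hi.toFun_flipAt hik hk hsi hsk
  have := hi.inj ((flipAt_of_ne hij s).trans hsi) ((flipAt_of_ne hik s).trans hsi)
    (h1.symm.trans h2)
  exact hjk (flipAt_right_inj.mp this)

/-- Every vertex of the `j`-face lies on one of the two `i`-faces, so crossing in direction `j` has
the same value as crossing in direction `i`. Hence the opposite `j`-face is a reflection of the
given one. -/
theorem FaceOnto.opposite {b : Bool} {i j : Fin (n + 1)} (hij : i ≠ j)
    (hi : ∀ a, FaceOnto τ Q a i) (hj : FaceOnto τ Q b j) : FaceOnto τ Q (!b) j := by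
  obtain ⟨k, rfl⟩ := (Fin.eq_self_or_eq_succAbove j i).resolve_left hij
  have h : SingCube.face (!b) j τ = SingCube.flip k (SingCube.face b j τ) := by
    refine GraphMap.ext (funext fun t => ?_)
    change τ.toFun (j.insertNth (!b) t) = τ.toFun (j.insertNth b (flipAt k t))
    rw [insertNth_flipAt, (hi _).toFun_flipAt hij hj rfl (by simp), flipAt_insertNth]
  unfold FaceOnto
  rw [h, injective_flip_iff, image_flip]
  exact hj

theorem exists_face_permute (π : Equiv.Perm (Fin (n + 1))) (b : Bool) (i : Fin (n + 1))
    (τ : SingCube G (n + 1)) : ∃ ρ : Equiv.Perm (Fin n),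
      SingCube.face b i (SingCube.permute π τ) =
        SingCube.permute ρ (SingCube.face b (π.symm i) τ) := by
  have h : ∀ m, ∃ k, π ((π.symm i).succAbove m) = i.succAbove k := fun m =>
    (Fin.eq_self_or_eq_succAbove i _).resolve_left fun h =>
      Fin.succAbove_ne (π.symm i) m (π.injective (by simpa using h))
  choose ρ hρ using h
  have hinj : Function.Injective ρ := fun m m' h => by
    have := (hρ m).trans ((congrArg i.succAbove h).trans (hρ m').symm)
    exact Fin.succAbove_right_injective (π.injective this)
  -- `ρ` is what `π` induces on the directions other than `π.symm i`.
  refine ⟨Equiv.ofBijective ρ (Finite.injective_iff_bijective.mp hinj), ?_⟩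
  refine GraphMap.ext (funext fun t => congrArg τ.toFun ?_)
  refine Fin.eq_insertNth_iff.mpr ⟨by simp, funext fun m => ?_⟩
  rw [Fin.removeNth_apply, Function.comp_apply, hρ, Fin.insertNth_apply_succAbove]
  rfl

/-- The comparison of two opposite faces with the same image. -/
theorem FaceOnto.exists_cubeMap {i : Fin (n + 1)} (hQ : Q.IsInduced)
    (hi : ∀ a, FaceOnto τ Q a i) : ∃ g : SingCube (cubeGraph n) n,
      Function.Injective g.toFun ∧ (∀ s, g.toFun s = s ∨ ∃ d, g.toFun s = flipAt d s) ∧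
      ∀ s, (SingCube.face true i τ).toFun s = (SingCube.face false i τ).toFun (g.toFun s) := by
  set p := SingCube.face false i τ with hp
  set q := SingCube.face true i τ with hq
  have hpQ : p.image = Q := (hi false).2
  have hqQ : q.image = Q := (hi true).2
  have hpi : Function.Injective p.toFun := (hi false).1
  have hqi : Function.Injective q.toFun := (hi true).1
  have hr : ∀ s, ∃ t, q.toFun s = p.toFun t := fun s => by
    have : q.toFun s ∈ p.image.verts := by rw [hpQ, ← hqQ]; exact ⟨s, rfl⟩
    obtain ⟨t, ht⟩ := this
    exact ⟨t, ht.symm⟩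
  have hadj : ∀ s t, Q.Adj (p.toFun s) (p.toFun t) → (cubeGraph n).Adj s t := by
    intro s t h
    rw [← hpQ] at h
    obtain ⟨-, v, w, hvw, hv, hw⟩ := h
    rwa [hpi hv, hpi hw] at hvw
  choose g hg using hr
  refine ⟨⟨g, fun s t h => Or.inl (hadj _ _ ?_)⟩, fun s t h => hqi ?_, fun s => ?_, hg⟩
  · rw [← hg, ← hg, ← hqQ]
    exact ⟨SingCube.adj_of_injective hqi h, s, t, h, rfl, rfl⟩
  · rw [hg, hg]; exact congrArg p.toFun h
  · have h1 : G.Adj (p.toFun s) (q.toFun s) ∨ p.toFun s = q.toFun s := by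
      refine τ.map_adj _ _ (cubeGraph_adj_iff.mpr ⟨i, ?_⟩)
      rw [flipAt_insertNth]; rfl
    rcases h1 with h1 | h1
    · right
      refine cubeGraph_adj_iff.mp (hadj _ _ ?_)
      rw [← hg]
      refine hQ ?_ ?_ h1
      · rw [← hpQ]; exact ⟨s, rfl⟩
      · rw [← hqQ]; exact ⟨s, rfl⟩
    · left
      exact hpi ((hg s).symm.trans h1.symm)

/-- If two opposite faces differ by a reflection, then the faces in the direction of this
reflection have the same image. -/
theorem FaceOnto.of_flipAt {i : Fin (n + 1)} (hi : ∀ a, FaceOnto τ Q a i) {k : Fin n}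
    (hk : ∀ s, (SingCube.face true i τ).toFun s =
      (SingCube.face false i τ).toFun (flipAt k s)) : FaceOnto τ Q false (i.succAbove k) := by
  obtain ⟨ρ, hρ⟩ := exists_face_permute (Equiv.swap i (i.succAbove k)) false i τ
  rw [Equiv.symm_swap, Equiv.swap_apply_left] at hρ
  -- The hypothesis says exactly that swapping the two directions does not change the values of `τ`
  -- on the front `i`-face.
  have h : SingCube.face false i (SingCube.permute (Equiv.swap i (i.succAbove k)) τ) =
      SingCube.face false i τ := by
    refine GraphMap.ext (funext fun t => ?_)
    change τ.toFun (i.insertNth false t ∘ Equiv.swap i (i.succAbove k)) =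
      τ.toFun (i.insertNth false t)
    have hne := Fin.succAbove_ne i k
    cases htk : t k
    · congr 1
      funext m
      rcases eq_or_ne m i with rfl | hm
      · simp [htk]
      rcases eq_or_ne m (i.succAbove k) with rfl | hm'
      · simp [htk]
      · simp [Equiv.swap_apply_of_ne_of_ne hm hm']
    · have := hk (flipAt k t)
      rw [flipAt_flipAt] at this
      refine Eq.trans (congrArg τ.toFun ?_) this
      funext m
      rcases eq_or_ne m i with rfl | hm
      · simp [htk]
      rcases eq_or_ne m (i.succAbove k) with rfl | hm'
      · simp [htk]
      · obtain ⟨l, rfl⟩ := (Fin.eq_self_or_eq_succAbove i m).resolve_left hm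
        have hl : l ≠ k := fun h => hm' (h ▸ rfl)
        simp [Equiv.swap_apply_of_ne_of_ne hm hm', flipAt_of_ne hl]
  rw [h] at hρ
  have h0 := hi false
  unfold FaceOnto at h0 ⊢
  rwa [hρ, injective_permute_iff, image_permute] at h0

end FaceOnto

/-! ## The cellular chain of a singular cube -/

section CellOf

variable {V : Type u} {G : SimpleGraph V} {n : ℕ}

/-- The cellular chain of `CW^□(G)` given by a singular cube: zero if the cube is not injective. -/
noncomputable def cellOf (σ : SingCube G n) :
    ((injSing G).cells n →₀ ℤ) ⧸ orientationRelations G n :=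
  open Classical in
  if h : Function.Injective σ.toFun then
    (orientationRelations G n).mkQ (Finsupp.single (⟨σ, h⟩ : (injSing G).cells n) 1) else 0

theorem cellOf_of_injective {σ : SingCube G n} (h : Function.Injective σ.toFun) :
    cellOf σ =
      (orientationRelations G n).mkQ (Finsupp.single (⟨σ, h⟩ : (injSing G).cells n) 1) :=
  dif_pos h

theorem cellOf_of_not_injective {σ : SingCube G n} (h : ¬Function.Injective σ.toFun) :
    cellOf σ = 0 :=
  dif_neg h

theorem cellOf_flip (i : Fin n) (σ : SingCube G n) :
    cellOf (SingCube.flip i σ) = -cellOf σ := by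
  by_cases h : Function.Injective σ.toFun
  · have h' := (injective_flip_iff i σ).mpr h
    rw [cellOf_of_injective h, cellOf_of_injective h', eq_neg_iff_add_eq_zero, add_comm,
      ← map_add]
    exact (Submodule.Quotient.mk_eq_zero _).mpr (Submodule.subset_span (Or.inl ⟨⟨σ, h⟩, i, rfl⟩))
  · rw [cellOf_of_not_injective h,
      cellOf_of_not_injective (fun h' => h ((injective_flip_iff i σ).mp h')), neg_zero]

theorem cellOf_permute_swap {i j : Fin n} (hij : i ≠ j) (σ : SingCube G n) :
    cellOf (SingCube.permute (Equiv.swap i j) σ) = -cellOf σ := by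
  by_cases h : Function.Injective σ.toFun
  · have h' := (injective_permute_iff (Equiv.swap i j) σ).mpr h
    rw [cellOf_of_injective h, cellOf_of_injective h', eq_neg_iff_add_eq_zero, add_comm,
      ← map_add]
    exact (Submodule.Quotient.mk_eq_zero _).mpr
      (Submodule.subset_span (Or.inr ⟨⟨σ, h⟩, i, j, hij, rfl⟩))
  · rw [cellOf_of_not_injective h,
      cellOf_of_not_injective (fun h' => h ((injective_permute_iff _ σ).mp h')), neg_zero]

/-- The contribution of the face `f_i^b τ` to the boundary of `τ`, as a cellular chain. -/
noncomputable def signedFace (b : Bool) (i : Fin (n + 1)) (τ : SingCube G (n + 1)) :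
    ((injSing G).cells n →₀ ℤ) ⧸ orientationRelations G n :=
  ((-1 : ℤ) ^ ((i : ℕ) + 1) * bif b then -1 else 1) • cellOf (SingCube.face b i τ)

theorem face_flip_same (i : Fin (n + 1)) (b : Bool) (τ : SingCube G (n + 1)) :
    SingCube.face b i (SingCube.flip i τ) = SingCube.face (!b) i τ :=
  GraphMap.ext (funext fun t => congrArg τ.toFun (flipAt_insertNth i b t))

theorem face_flip_succAbove (j : Fin (n + 1)) (k : Fin n) (b : Bool) (τ : SingCube G (n + 1)) :
    SingCube.face b j (SingCube.flip (j.succAbove k) τ) =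
      SingCube.flip k (SingCube.face b j τ) :=
  GraphMap.ext (funext fun t => congrArg τ.toFun (insertNth_flipAt j b k t).symm)

theorem face_permute_succAbove (j : Fin (n + 1)) (k l : Fin n) (b : Bool)
    (τ : SingCube G (n + 1)) :
    SingCube.face b j (SingCube.permute (Equiv.swap (j.succAbove k) (j.succAbove l)) τ) =
      SingCube.permute (Equiv.swap k l) (SingCube.face b j τ) := by
  refine GraphMap.ext (funext fun t => congrArg τ.toFun (funext fun m => ?_))
  rcases Fin.eq_self_or_eq_succAbove j m with rfl | ⟨m, rfl⟩
  · simp [Equiv.swap_apply_of_ne_of_ne (Fin.succAbove_ne m k).symm (Fin.succAbove_ne m l).symm]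
  · have : Equiv.swap (j.succAbove k) (j.succAbove l) (j.succAbove m) =
        j.succAbove (Equiv.swap k l m) :=
      (Fin.succAbove_right_injective.map_swap k l m).symm
    simp [this]

theorem face_permute_castSucc (k : Fin n) (b : Bool) (τ : SingCube G (n + 1)) :
    SingCube.face b k.castSucc (SingCube.permute (Equiv.swap k.castSucc k.succ) τ) =
      SingCube.face b k.succ τ := by
  refine GraphMap.ext (funext fun t => congrArg τ.toFun ?_)
  refine Fin.eq_insertNth_iff.mpr ⟨by simp, funext fun m => ?_⟩
  rw [Fin.removeNth_apply, Function.comp_apply]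
  have h : Equiv.swap k.castSucc k.succ (k.succ.succAbove m) = k.castSucc.succAbove m := by
    rcases lt_trichotomy m k with h | rfl | h
    · rw [Fin.succAbove_of_castSucc_lt _ _ (Fin.castSucc_lt_succ_iff.mpr h.le),
        Fin.succAbove_of_castSucc_lt _ _ (Fin.castSucc_lt_castSucc_iff.mpr h),
        Equiv.swap_apply_of_ne_of_ne]
      · exact (Fin.castSucc_lt_castSucc_iff.mpr h).ne
      · exact (Fin.castSucc_lt_succ_iff.mpr h.le).ne
    · rw [Fin.succAbove_of_castSucc_lt _ _ (Fin.castSucc_lt_succ_iff.mpr le_rfl),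
        Fin.succAbove_of_le_castSucc _ _ le_rfl, Equiv.swap_apply_left]
    · rw [Fin.succAbove_of_le_castSucc _ _ (Fin.succ_le_castSucc_iff.mpr h),
        Fin.succAbove_of_le_castSucc _ _ (Fin.castSucc_le_castSucc_iff.mpr h.le),
        Equiv.swap_apply_of_ne_of_ne]
      · exact (Fin.castSucc_lt_succ_iff.mpr h.le).ne'
      · exact (Fin.succ_lt_succ_iff.mpr h).ne'
  rw [h, Fin.insertNth_apply_succAbove]

theorem permute_mul (π ρ : Equiv.Perm (Fin n)) (σ : SingCube G n) :
    SingCube.permute (π * ρ) σ = SingCube.permute π (SingCube.permute ρ σ) := rfl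

theorem face_permute_succ (k : Fin n) (b : Bool) (τ : SingCube G (n + 1)) :
    SingCube.face b k.succ (SingCube.permute (Equiv.swap k.castSucc k.succ) τ) =
      SingCube.face b k.castSucc τ := by
  rw [← face_permute_castSucc, ← permute_mul, Equiv.swap_mul_self]
  rfl

theorem signedFace_flip_same (b : Bool) (i : Fin (n + 1)) (τ : SingCube G (n + 1)) :
    signedFace b i (SingCube.flip i τ) = -signedFace (!b) i τ := by
  unfold signedFace
  rw [face_flip_same, ← neg_smul]
  cases b <;> simp

theorem signedFace_flip_of_ne (b : Bool) {i j : Fin (n + 1)} (hij : i ≠ j)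
    (τ : SingCube G (n + 1)) :
    signedFace b i (SingCube.flip j τ) = -signedFace b i τ := by
  obtain ⟨k, rfl⟩ := (Fin.eq_self_or_eq_succAbove i j).resolve_left hij.symm
  unfold signedFace
  rw [face_flip_succAbove, cellOf_flip, smul_neg]

/-- An adjacent transposition either moves the face to a neighbouring index, which changes the sign
`(-1)^i`, or acts on the face as a transposition, which reverses its orientation. Each costs one
sign, and adjacent transpositions generate. -/
theorem signedFace_permute (π : Equiv.Perm (Fin (n + 1))) (b : Bool) (i : Fin (n + 1))
    (τ : SingCube G (n + 1)) :
    signedFace b i (SingCube.permute π τ) =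
      ((Equiv.Perm.sign π : ℤˣ) : ℤ) • signedFace b (π.symm i) τ := by
  have hπ : π ∈ Submonoid.closure
      (Set.range fun i : Fin n => Equiv.swap i.castSucc i.succ) := by
    rw [Equiv.Perm.mclosure_swap_castSucc_succ]; trivial
  induction hπ using Submonoid.closure_induction generalizing i τ with
  | mem π h =>
    obtain ⟨k, rfl⟩ := h
    have hk := (Fin.castSucc_lt_succ (i := k)).ne
    simp only [Equiv.Perm.sign_swap hk, Equiv.symm_swap, Units.val_neg, Units.val_one, neg_smul,
      one_smul]
    by_cases h1 : i = k.castSucc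
    · subst h1
      rw [Equiv.swap_apply_left]
      unfold signedFace
      rw [face_permute_castSucc, ← neg_smul]
      simp [pow_succ]
    by_cases h2 : i = k.succ
    · subst h2
      rw [Equiv.swap_apply_right]
      unfold signedFace
      rw [face_permute_succ, ← neg_smul]
      simp [pow_succ]
    rw [Equiv.swap_apply_of_ne_of_ne h1 h2]
    obtain ⟨a, ha⟩ := (Fin.eq_self_or_eq_succAbove i k.castSucc).resolve_left (Ne.symm h1)
    obtain ⟨c, hc⟩ := (Fin.eq_self_or_eq_succAbove i k.succ).resolve_left (Ne.symm h2)
    have hac : a ≠ c := by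
      rintro rfl
      exact hk (ha.trans hc.symm)
    unfold signedFace
    rw [ha, hc, face_permute_succAbove, cellOf_permute_swap hac, smul_neg]
  | one =>
    have h : SingCube.permute 1 τ = τ := rfl
    rw [h, Equiv.Perm.sign_one, Units.val_one, one_smul]
    rfl
  | mul π ρ _ _ h1 h2 =>
    rw [permute_mul, h1, h2, smul_smul, Equiv.Perm.sign_mul, Units.val_mul]
    rfl

theorem signedFace_permute_swap (b : Bool) {i j : Fin (n + 1)} (hij : i ≠ j)
    (τ : SingCube G (n + 1)) :
    signedFace b i (SingCube.permute (Equiv.swap i j) τ) = -signedFace b j τ := by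
  rw [signedFace_permute, Equiv.Perm.sign_swap hij]
  simp

/-- By hypothesis the `i`-face is unchanged when `τ` is composed with the swap of `i` and `j`, while
`signedFace_permute_swap` turns its contribution into minus that of the `j`-face. -/
theorem signedFace_add_signedFace_of_eq {b : Bool} {i j : Fin (n + 1)} (hij : i ≠ j)
    {τ : SingCube G (n + 1)}
    (h : ∀ s, s i = b → s j = b → τ.toFun (flipAt i s) = τ.toFun (flipAt j s)) :
    signedFace b i τ + signedFace b j τ = 0 := by
  have hf : SingCube.face b i (SingCube.permute (Equiv.swap i j) τ) = SingCube.face b i τ := by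
    refine GraphMap.ext (funext fun t => ?_)
    change τ.toFun (i.insertNth b t ∘ Equiv.swap i j) = τ.toFun (i.insertNth b t)
    have hi : (i.insertNth b t : Fin (n + 1) → Bool) i = b := by simp
    generalize (i.insertNth b t : Fin (n + 1) → Bool) = s at hi
    by_cases hj : s j = b
    · congr 1
      funext m
      rcases eq_or_ne m i with rfl | hm
      · simp [hi, hj]
      rcases eq_or_ne m j with rfl | hm'
      · simp [hi, hj]
      · simp [Equiv.swap_apply_of_ne_of_ne hm hm']
    · have hj' : s j = !b := by revert hj; cases s j <;> cases b <;> simp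
      have := h (flipAt j s) (by rw [flipAt_of_ne hij, hi]) (by simp [hj'])
      rw [flipAt_flipAt] at this
      rw [← this]
      congr 1
      funext m
      rcases eq_or_ne m i with rfl | hm
      · simp [hj', flipAt_of_ne hij, hi]
      rcases eq_or_ne m j with rfl | hm'
      · simp [hi, flipAt_of_ne hij.symm, hj']
      · simp [Equiv.swap_apply_of_ne_of_ne hm hm', flipAt_of_ne hm, flipAt_of_ne hm']
  have h1 := signedFace_permute_swap b hij τ
  rw [eq_neg_iff_add_eq_zero] at h1
  rw [← h1]
  unfold signedFace
  rw [hf]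

theorem FaceOnto.signedFace_add {τ : SingCube G (n + 1)} {Q : G.Subgraph} {a b : Bool}
    {i j : Fin (n + 1)} (hij : i ≠ j) (hi : FaceOnto τ Q a i) (hj : FaceOnto τ Q b j) :
    signedFace a i τ + signedFace b j τ = 0 := by
  by_cases hab : b = a
  · subst hab
    exact signedFace_add_signedFace_of_eq hij fun s hs ht => hi.toFun_flipAt hij hj hs ht
  · have hab' : b = !a := by revert hab; cases a <;> cases b <;> simp
    subst hab'
    -- Reflecting `τ` in direction `j` reduces a front and a back face to two faces of the same
    -- kind, at the cost of a common sign.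
    have := signedFace_add_signedFace_of_eq (b := a) (τ := SingCube.flip j τ) hij ?_
    · rwa [signedFace_flip_of_ne a hij, signedFace_flip_same, ← neg_add, neg_eq_zero] at this
    · intro s hs ht
      change τ.toFun (flipAt j (flipAt i s)) = τ.toFun (flipAt j (flipAt j s))
      rw [flipAt_comm]
      exact hi.toFun_flipAt hij hj (by rw [flipAt_of_ne hij, hs]) (by simp [ht])

/-- If no other face has the same image, then two opposite faces with the same image cancel. -/
theorem FaceOnto.signedFace_opposite {τ : SingCube G (n + 1)} {Q : G.Subgraph}
    (hQ : Q.IsInduced) {i : Fin (n + 1)} (hi : ∀ a, FaceOnto τ Q a i)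
    (h : ∀ b j, j ≠ i → ¬FaceOnto τ Q b j) :
    signedFace false i τ + signedFace true i τ = 0 := by
  suffices hc : cellOf (SingCube.face true i τ) = cellOf (SingCube.face false i τ) by
    unfold signedFace
    rw [hc, ← add_smul]
    simp
  obtain ⟨g, hg, hd, hgq⟩ := FaceOnto.exists_cubeMap hQ hi
  -- A reflection contradicts `h`. A quarter turn is a transposition after a reflection, so its two
  -- orientation signs cancel.
  rcases cubeMap_trichotomy hg hd with h1 | ⟨k, hk⟩ | ⟨k, a, c, hka, hc⟩
  · congr 1
    refine GraphMap.ext (funext fun s => ?_)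
    rw [hgq, h1]
  · exact absurd (FaceOnto.of_flipAt hi fun s => by rw [hgq, hk]) (h _ _ (Fin.succAbove_ne i k))
  · have : SingCube.face true i τ = SingCube.permute (Equiv.swap k a)
        (SingCube.flip c (SingCube.face false i τ)) := by
      refine GraphMap.ext (funext fun s => ?_)
      rw [hgq, hc]
      rfl
    rw [this, cellOf_permute_swap hka, cellOf_flip, neg_neg]

theorem sum_signedFace_onto (hG : IsQuasimonophobic G n) {τ : SingCube G (n + 1)}
    (hτ : ¬Function.Injective τ.toFun) {Q : G.Subgraph} {b : Bool} {i : Fin (n + 1)}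
    (hi : FaceOnto τ Q b i) :
    ∑ p : Fin (n + 1) × Bool, (open Classical in
      if FaceOnto τ Q p.2 p.1 then signedFace p.2 p.1 τ else 0) = 0 := by
  classical
  rw [Fintype.sum_prod_type]
  set w : Bool → Fin (n + 1) → ((injSing G).cells n →₀ ℤ) ⧸ orientationRelations G n :=
    fun b i => if FaceOnto τ Q b i then signedFace b i τ else 0 with hw
  have hcube : IsCube n Q := hi.2 ▸ isCube_image hi.1
  obtain ⟨hQ, hmono⟩ := hG Q hcube
  obtain ⟨c, j, hne, hj⟩ := hmono τ hτ b i hi.2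
  replace hj : FaceOnto τ Q c j := ⟨injective_of_image_eq hi.1 (hj.trans hi.2.symm), hj⟩
  -- two directions
  have main : ∀ b c i j, i ≠ j → FaceOnto τ Q b i → FaceOnto τ Q c j →
      ∑ k, ∑ a, w a k = 0 := by
    intro b c i j hij hi hj
    have hall : ∀ {b i}, FaceOnto τ Q b i → FaceOnto τ Q (!b) i → ∀ a, FaceOnto τ Q a i := by
      intro b i h1 h2 a
      cases a <;> cases b <;> assumption
    rw [← Finset.add_sum_erase _ _ (Finset.mem_univ i),
      ← Finset.add_sum_erase _ _ (Finset.mem_erase.mpr ⟨hij.symm, Finset.mem_univ j⟩),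
      Finset.sum_eq_zero (s := (Finset.univ.erase i).erase j), add_zero]
    · have e : ∀ b k, ∑ a, w a k = w b k + w (!b) k := by
        intro b k
        cases b <;> simp [add_comm]
      rw [e b i, e c j]
      have h1 : w b i + w c j = 0 := by
        simp only [hw, if_pos hi, if_pos hj]
        exact hi.signedFace_add hij hj
      have h2 : w (!b) i + w (!c) j = 0 := by
        by_cases hi' : FaceOnto τ Q (!b) i
        · have hj' := FaceOnto.opposite hij (hall hi hi') hj
          simp only [hw, if_pos hi', if_pos hj']
          exact hi'.signedFace_add hij hj'
        · have hj' : ¬FaceOnto τ Q (!c) j := fun hj' =>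
            hi' (FaceOnto.opposite hij.symm (hall hj hj') hi)
          simp only [hw, if_neg hi', if_neg hj', add_zero]
      calc _ = (w b i + w c j) + (w (!b) i + w (!c) j) := by abel
        _ = 0 := by rw [h1, h2, add_zero]
    · intro k hk
      simp only [Finset.mem_erase, Finset.mem_univ, and_true] at hk
      refine Finset.sum_eq_zero fun a _ => if_neg fun hk' => ?_
      exact FaceOnto.not_three hij hk.2.symm hk.1.symm hi hj hk'
  by_cases hij : i = j
  · subst hij
    have hcb : c = !b := by
      revert hne
      cases b <;> cases c <;> simp
    have hall : ∀ a, FaceOnto τ Q a i := by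
      intro a
      subst hcb
      cases a <;> cases b <;> assumption
    -- Even if the second face is opposite to the first, a face in another direction may also be
    -- onto `Q`; then the two-direction count applies.
    by_cases hex : ∃ a k, k ≠ i ∧ FaceOnto τ Q a k
    · obtain ⟨a, k, hk, hak⟩ := hex
      exact main b a i k hk.symm hi hak
    · push Not at hex
      rw [Finset.sum_eq_single i]
      · simp only [Fintype.sum_bool, if_pos (hall _)]
        rw [add_comm]
        exact FaceOnto.signedFace_opposite hQ hall hex
      · intro k _ hk
        exact Finset.sum_eq_zero fun a _ => if_neg (hex a k hk)
      · simp
  · exact main b c i j hij hi hj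

/-- The injective faces of a noninjective cube cancel in the cellular chains of a
quasimonophobic graph. -/
theorem sum_signedFace_eq_zero (hG : IsQuasimonophobic G n) {τ : SingCube G (n + 1)}
    (hτ : ¬Function.Injective τ.toFun) :
    ∑ p : Fin (n + 1) × Bool, signedFace p.2 p.1 τ = 0 := by
  classical
  rw [← Finset.sum_fiberwise_of_maps_to
    (t := Finset.univ.image fun p : Fin (n + 1) × Bool => (SingCube.face p.2 p.1 τ).image)
    (g := fun p => (SingCube.face p.2 p.1 τ).image)
    (fun p hp => Finset.mem_image_of_mem _ hp)]
  refine Finset.sum_eq_zero fun Q _ => ?_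
  rw [Finset.sum_filter]
  -- Noninjective faces contribute zero, so each fibre may be restricted to the faces satisfying
  -- `FaceOnto`.
  have hs : ∀ p : Fin (n + 1) × Bool, (if (SingCube.face p.2 p.1 τ).image = Q then
      signedFace p.2 p.1 τ else 0) =
      if FaceOnto τ Q p.2 p.1 then signedFace p.2 p.1 τ else 0 := by
    intro p
    by_cases hinj : Function.Injective (SingCube.face p.2 p.1 τ).toFun
    · simp [FaceOnto, hinj]
    · simp [FaceOnto, hinj, signedFace, cellOf_of_not_injective hinj]
  rw [Finset.sum_congr rfl fun p _ => hs p]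
  by_cases hex : ∃ p : Fin (n + 1) × Bool, FaceOnto τ Q p.2 p.1
  · obtain ⟨p, hp⟩ := hex
    convert sum_signedFace_onto hG hτ hp
  · exact Finset.sum_eq_zero fun p _ => if_neg fun h => hex ⟨p, h⟩

end CellOf

/-! ## Vanishing of homology classes -/

section Homology

variable {K L M : ChainComplex (ModuleCat.{u} ℤ) ℕ} {n : ℕ}

theorem homologyπ_eq_zero_iff (z : K.cycles n) :
    K.homologyπ n z = 0 ↔ ∃ y, K.d (n + 1) n y = K.iCycles n z := by
  have hex : (ShortComplex.mk _ _ (K.toCycles_comp_homologyπ (n + 1) n)).Exact :=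
    ShortComplex.exact_of_g_is_cokernel _ (K.homologyIsCokernel (n + 1) n (by simp))
  rw [ShortComplex.moduleCat_exact_iff] at hex
  have hi : ∀ y, K.iCycles n (K.toCycles (n + 1) n y) = K.d (n + 1) n y := fun y => by
    rw [← ConcreteCategory.comp_apply, K.toCycles_i]
  constructor
  · intro h
    obtain ⟨y, hy⟩ := hex z h
    exact ⟨y, (hi y).symm.trans (congrArg (K.iCycles n) hy)⟩
  · rintro ⟨y, hy⟩
    have hinj := (ModuleCat.mono_iff_injective (K.iCycles n)).mp inferInstance
    have hz : K.toCycles (n + 1) n y = z := hinj ((hi y).trans hy)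
    rw [← hz, ← ConcreteCategory.comp_apply, K.toCycles_comp_homologyπ]
    rfl

theorem homologyMap_cycleClass (f : K ⟶ L) (x : K.X n) (hx : IsCycle K x) :
    ∃ hfx : IsCycle L (f.f n x),
      HomologicalComplex.homologyMap f n (cycleClass K x hx) = cycleClass L (f.f n x) hfx := by
  have hfx : IsCycle L (f.f n x) := fun m => by
    rw [← ConcreteCategory.comp_apply, f.comm, ConcreteCategory.comp_apply, hx m, map_zero]
  refine ⟨hfx, ?_⟩
  unfold cycleClass
  rw [← ConcreteCategory.comp_apply, HomologicalComplex.homologyπ_naturality,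
    ConcreteCategory.comp_apply]
  refine congrArg _ ((ModuleCat.mono_iff_injective (L.iCycles n)).mp inferInstance ?_)
  rw [← ConcreteCategory.comp_apply, HomologicalComplex.cyclesMap_i, ConcreteCategory.comp_apply]
  exact (congrArg (f.f n) (K.i_cyclesMk x _ rfl (hx _))).trans
    (L.i_cyclesMk _ _ rfl (hfx _)).symm

theorem cycleClass_eq_zero_iff (x : K.X n) (hx : IsCycle K x) :
    cycleClass K x hx = 0 ↔ ∃ y, K.d (n + 1) n y = x :=
  (homologyπ_eq_zero_iff _).trans
    (exists_congr fun _ => by rw [show K.iCycles n (K.cyclesMk x _ rfl (hx _)) = x from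
      K.i_cyclesMk x _ rfl (hx _)])

/-- The image of the class of a cycle under two chain maps vanishes if and only if the image of
the cycle is a boundary. -/
theorem homologyMap_homologyMap_cycleClass_eq_zero_iff (f : K ⟶ L) (g : L ⟶ M) (x : K.X n)
    (hx : IsCycle K x) :
    HomologicalComplex.homologyMap g n
        (HomologicalComplex.homologyMap f n (cycleClass K x hx)) = 0 ↔
      ∃ y, M.d (n + 1) n y = g.f n (f.f n x) := by
  obtain ⟨h1, e1⟩ := homologyMap_cycleClass f x hx
  obtain ⟨h2, e2⟩ := homologyMap_cycleClass g _ h1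
  rw [e1, e2, cycleClass_eq_zero_iff]

end Homology

/-! ## From singular chains to cellular chains -/

section Comparison

variable {V : Type u} {G : SimpleGraph V} {n : ℕ}

variable (G n) in
/-- The linear map sending injective singular cubes to cells and all others to zero. -/
noncomputable def toCellular :
    ((sing G).cells n →₀ ℤ) →ₗ[ℤ] ((injSing G).cells n →₀ ℤ) ⧸ orientationRelations G n :=
  Finsupp.linearCombination ℤ fun σ : SingCube G n => cellOf σ

theorem toCellular_single (σ : (sing G).cells n) :
    toCellular G n (Finsupp.single σ 1) = cellOf (n := n) σ :=
  (Finsupp.linearCombination_single ℤ _ _).trans (one_smul ℤ _)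

/-- A degenerate cube identifies two vertices that differ in a single coordinate, so it is not
injective. -/
theorem toCellular_degenerate : degenerateChains G n ≤ LinearMap.ker (toCellular G n) := by
  refine Submodule.span_le.mpr ?_
  rintro _ ⟨σ, hσ, rfl⟩
  rw [SetLike.mem_coe, LinearMap.mem_ker, toCellular_single]
  refine cellOf_of_not_injective fun h => ?_
  cases n with
  | zero => exact hσ
  | succ n =>
    obtain ⟨i, hi⟩ := hσ
    have := congrFun (congrArg GraphMap.toFun hi) fun _ => false
    have h' := congrFun (h this) i
    simp at h'

theorem toCellular_boundary_single (τ : (sing G).cells (n + 1)) :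
    toCellular G n ((sing G).boundary n (Finsupp.single τ 1)) =
      ∑ p : Fin (n + 1) × Bool, signedFace p.2 p.1 τ := by
  rw [SemiCubicalSet.boundary_single, map_sum, Fintype.sum_prod_type]
  refine Finset.sum_congr rfl fun i _ => ?_
  rw [map_smul, map_sub, toCellular_single, toCellular_single, Fintype.sum_bool]
  unfold signedFace
  simp only [cond_true, cond_false, mul_neg, mul_one, neg_smul, smul_sub]
  exact (sub_eq_add_neg _ _).trans (add_comm _ _)

/-- This single square replaces a full chain map, so the condition on `G` is needed in degree `n`
alone. For injective `τ` all faces are injective and the two sides agree term by term; otherwise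
both sides vanish. -/
theorem toCellular_boundary (hG : IsQuasimonophobic G n) :
    toCellular G n ∘ₗ (sing G).boundary n =
      (orientationRelations G (n + 1)).mapQ (orientationRelations G n) ((injSing G).boundary n)
        (orientationRelations_le G n) ∘ₗ toCellular G (n + 1) := by
  apply Finsupp.lhom_ext'
  intro τ
  apply LinearMap.ext_ring
  simp only [LinearMap.comp_apply, Finsupp.lsingle_apply]
  rw [toCellular_single]
  by_cases hτ : Function.Injective (GraphMap.toFun τ)
  · rw [cellOf_of_injective hτ]
    change _ = (orientationRelations G n).mkQ
      ((injSing G).boundary n (Finsupp.single (⟨τ, hτ⟩ : (injSing G).cells (n + 1)) 1))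
    refine Eq.trans (congrArg _ ((sing G).boundary_single τ))
      (Eq.trans ?_ (congrArg _ ((injSing G).boundary_single ⟨τ, hτ⟩)).symm)
    rw [map_sum, map_sum]
    refine Finset.sum_congr rfl fun i _ => ?_
    have h : ∀ b, toCellular G n (Finsupp.single ((sing G).face b i τ) 1) =
        (orientationRelations G n).mkQ (Finsupp.single
          ((injSing G).face b i (⟨τ, hτ⟩ : (injSing G).cells (n + 1))) 1) := fun b =>
      (toCellular_single _).trans (cellOf_of_injective _)
    rw [map_smul, map_smul, map_sub, map_sub, h, h]
  · rw [cellOf_of_not_injective hτ, map_zero, toCellular_boundary_single,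
      sum_signedFace_eq_zero hG hτ]

/-- A combination of injective singular cubes that bounds in the singular chains of a
quasimonophobic graph bounds in the cellular chains. -/
theorem exists_cellular_boundary (hG : IsQuasimonophobic G n)
    (x : (injSing G).cells n →₀ ℤ)
    (h : ∃ y : (cubicalChains G).X (n + 1), (cubicalChains G).d (n + 1) n y =
      (degenerateChains G n).mkQ
        (Finsupp.mapDomain (fun σ : (injSing G).cells n => σ.1) x)) :
    ∃ y : (cellularChains G).X (n + 1), (cellularChains G).d (n + 1) n y =
      (orientationRelations G n).mkQ x := by
  obtain ⟨y, hy⟩ := h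
  obtain ⟨y, rfl⟩ := (degenerateChains G (n + 1)).mkQ_surjective y
  refine ⟨toCellular G (n + 1) y, ?_⟩
  unfold cellularChains
  unfold cubicalChains at hy
  rw [SemiCubicalSet.quotientChains_d] at hy ⊢
  have h1 := LinearMap.congr_fun (toCellular_boundary hG) y
  refine (Eq.symm h1).trans ?_
  have h2 : (degenerateChains G n).mkQ ((sing G).boundary n y) = (degenerateChains G n).mkQ
      (Finsupp.mapDomain (fun σ : (injSing G).cells n => σ.1) x) := hy
  rw [← sub_eq_zero, ← map_sub, ← LinearMap.mem_ker, Submodule.ker_mkQ] at h2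
  have h3 := toCellular_degenerate h2
  rw [LinearMap.mem_ker, map_sub, sub_eq_zero] at h3
  refine h3.trans ?_
  have h4 : toCellular G n ∘ₗ
      Finsupp.lmapDomain ℤ ℤ (fun σ : (injSing G).cells n => σ.1) =
        (orientationRelations G n).mkQ := by
    apply Finsupp.lhom_ext'
    intro σ
    apply LinearMap.ext_ring
    exact (congrArg (toCellular G n) (Finsupp.mapDomain_single)).trans
      ((toCellular_single σ.1).trans (cellOf_of_injective σ.2))
  exact LinearMap.congr_fun h4 x

end Comparison

end DiscreteCubical

theorem mainTheorem7 (n : ℕ)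
    (X : DiscreteCubical.SemiCubicalSet.{u}) (hX : X.IsRegular)
    (x : X.cells n →₀ ℤ) (hx : DiscreteCubical.IsCycle X.chains (n := n) x)
    {V : Type u} (G : SimpleGraph V) (hG : DiscreteCubical.IsQuasimonophobic G n)
    (α : DiscreteCubical.GraphMap X.graph G) (hα : Function.Injective α.toFun)
    (hCW : HomologicalComplex.homologyMap (DiscreteCubical.cellularChainsMap α hα) n
      (X.cwClass hX x hx) ≠ 0) :
    HomologicalComplex.homologyMap (DiscreteCubical.cubicalChainsMap α) n
      (X.graphClass x hx) ≠ 0 := by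
  contrapose! hCW
  replace hCW := (DiscreteCubical.homologyMap_homologyMap_cycleClass_eq_zero_iff
    (L := DiscreteCubical.cubicalChains X.graph)
    (X.toSing.toQuotientChains (DiscreteCubical.degenerateChains X.graph)
      (DiscreteCubical.degenerateChains_le X.graph))
    (DiscreteCubical.cubicalChainsMap α) x hx).mp hCW
  refine (DiscreteCubical.homologyMap_homologyMap_cycleClass_eq_zero_iff
    (L := DiscreteCubical.cellularChains X.graph)
    ((X.toInjSing hX).toQuotientChains (DiscreteCubical.orientationRelations X.graph)
      (DiscreteCubical.orientationRelations_le X.graph))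
    (DiscreteCubical.cellularChainsMap α hα) x hx).mpr ?_
  -- By regularity and injectivity of `α` the cells become injective cubes of `G`, so the chain
  -- carried along `ι` represents both classes.
  let ι : X.cells n → (DiscreteCubical.injSing G).cells n := fun c =>
    (DiscreteCubical.injSingMap α hα).app n ((X.toInjSing hX).app n c)
  obtain ⟨y, hy⟩ := DiscreteCubical.exists_cellular_boundary hG (Finsupp.mapDomain ι x) (by
    obtain ⟨y, hy⟩ := hCW
    refine ⟨y, hy.trans ?_⟩
    change (DiscreteCubical.degenerateChains G n).mkQ
      (Finsupp.mapDomain ((DiscreteCubical.singMap α).app n)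
        (Finsupp.mapDomain (X.toSing.app n) x)) = _
    exact congrArg _ (Finsupp.mapDomain_comp.symm.trans
      (Finsupp.mapDomain_comp (f := ι) (g := Subtype.val))))
  refine ⟨y, hy.trans ?_⟩
  change _ = (DiscreteCubical.orientationRelations G n).mkQ
    (Finsupp.mapDomain ((DiscreteCubical.injSingMap α hα).app n)
      (Finsupp.mapDomain ((X.toInjSing hX).app n) x))
  exact congrArg _ (Finsupp.mapDomain_comp (f := (X.toInjSing hX).app n)
    (g := (DiscreteCubical.injSingMap α hα).app n))
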